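/- Let $\phi$ be a nonnegative Borel measure on $(0,\infty)$ with $\int_{(0,\infty)}(y^2\wedge y)\,\phi(dy)<\infty$ and $\int_{(0,1)}y\,\phi(dy)=\infty$, and put $\psi(\xi)=\int_{(0,\infty)}(e^{-\xi y}-1+\xi y)\,\phi(dy)$ for $\Re\xi\ge 0$. Let $h>0$ and let $(\mathcal G_j)_{j\ge0}$ be the coefficients in $\psi((1-\xi)/h)=\sum_{j\ge0}\mathcal G_j\xi^j$, $|\xi|<1$. Let $Y^h$ be the càdlàg compound Poisson process on $\mathbb R$ with generator $f\mapsto\sum_{j\ge0}\mathcal G_j f(\cdot+(j-1)h)$, i.e. $Y^h$ leaves each state at rate $-\mathcal G_1$ and then moves by $(j-1)h$ with probability $\mathcal G_j/(-\mathcal G_1)$, $j\ne1$. For a càdlàg path $f$ on $[0,\infty)$ and a Borel set $B\subset\mathbb R$ let $A_{f,B}(t)=\int_0^t\mathbf 1_{\{f(z)\in B\}}\,dz$ and $A_{f,B}^{-1}(t)=\inf\{s>0:A_{f,B}(s)>t\}$. For paths with $A_{f,B}(\infty)=\infty$, where $B=(-1,\infty)$ respectively $B=(-\infty,1)$, define $\mathrm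 N^l(f)=f\circ A^{-1}_{f,(-1,\infty)}$ (left fast-forwarding, deleting the time spent in $(-\infty,-1]$) and $\mathrm N^r(f)=f\circ A^{-1}_{f,(-\infty,1)}$ (right fast-forwarding, deleting the time spent in $[1,\infty)$). The first jump time of a process $X$ is $J_1=\inf\{t\ge0:X_t\ne X_0\}$, and $X$ lands on $X_{J_1}$. (1) If $Y^h_0=-1+h$, then almost surely $Y^h$ spends an infinite amount of time in $(-1,\infty)$, so that $\mathrm N^l(Y^h)$ is well defined; the first jump time of $\mathrm N^l(Y^h)$ is exponentially distributed with rate $\mathcal G_0$; and for each integer $j\ge1$ the process $\mathrm N^l(Y^h)$ lands at its first jump on $-1+(1+j)h$ with probability $-\big(\sum_{i=0}^{j}\mathcal G_i\big)/\mathcal G_0$. (2) If $Y^h_0=1-h$, then almost surely $Y^h$ spends an infinite amount of time in $(-\infty,1)$, so that $\mathrm N^r(Y^h)$ is well defined; the first jump time of $\mathrm N^r(Y^h)$ is exponentially distributed with rate $\mathcal G_0$; and almost surely it lands at its first jump on $1-2h$. -/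

import Mathlib

open MeasureTheory ProbabilityTheory Set Filter Topology

noncomputable section

/-! ### The Lévy measure, the Laplace exponent and the Grünwald coefficients -/

/-- A nonnegative Borel measure `φ` on `(0,∞)` with `∫ (y² ∧ y) φ(dy) < ∞` and
`∫_{(0,1)} y φ(dy) = ∞`. A measure on `ℝ` is only ever looked at on `(0,∞)`. -/
structure AdmissibleLevyMeasure (φ : Measure ℝ) : Prop where
  lintegral_lt_top : ∫⁻ y in Ioi (0 : ℝ), ENNReal.ofReal (min (y ^ 2) y) ∂φ < ⊤
  lintegral_eq_top : ∫⁻ y in Ioo (0 : ℝ) 1, ENNReal.ofReal y ∂φ = ⊤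

/-- `ψ(ξ) = ∫_{(0,∞)} (e^{-ξ y} - 1 + ξ y) φ(dy)`, for `Re ξ ≥ 0`. -/
def laplaceExponent (φ : Measure ℝ) (ξ : ℂ) : ℂ :=
  ∫ y in Ioi (0 : ℝ), (Complex.exp (-ξ * (y : ℂ)) - 1 + ξ * (y : ℂ)) ∂φ

/-- The coefficient `𝒢_j` of the power series `ψ((1 - ξ) / h) = ∑_j 𝒢_j ξ^j`, `|ξ| < 1`
(these Taylor coefficients at `0` are real numbers). -/
def grunwaldCoeff (φ : Measure ℝ) (h : ℝ) (j : ℕ) : ℝ :=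
  (iteratedDeriv j (fun ξ : ℂ => laplaceExponent φ ((1 - ξ) / (h : ℂ))) 0 /
    (j.factorial : ℂ)).re

/-! ### Compound Poisson processes -/

/-- The number of arrivals up to time `t`, given the sequence `e 0, e 1, …` of waiting times
between consecutive arrivals. -/
def arrivalCount (e : ℕ → ℝ) (t : ℝ) : ℕ :=
  Set.ncard {m : ℕ | ∑ i ∈ Finset.range (m + 1), e i ≤ t}

/-- `Y` is (indistinguishable from) a compound Poisson process started at `x`, with jump rate `r`
and jump distribution `ν`: `Y_t = x + ξ_0 + ⋯ + ξ_{N_t - 1}`, where `N` is the Poisson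
process with i.i.d. exponential waiting times `E` of rate `r`, the jumps `ξ` are i.i.d. with law
`ν`, and all the waiting times and jumps are independent. -/
def IsCompoundPoisson {Ω : Type*} [MeasurableSpace Ω] (P : Measure Ω) (Y : ℝ → Ω → ℝ)
    (x r : ℝ) (ν : Measure ℝ) : Prop :=
  ∃ E ξ : ℕ → Ω → ℝ,
    (∀ m, HasLaw (E m) (expMeasure r) P) ∧
    (∀ m, HasLaw (ξ m) ν P) ∧
    iIndepFun (Sum.elim E ξ) P ∧
    ∀ᵐ ω ∂P, ∀ t : ℝ, 0 ≤ t →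
      Y t ω = x + ∑ m ∈ Finset.range (arrivalCount (fun i => E i ω) t), ξ m ω

/-- The jump distribution `∑_{j ≠ 1} (𝒢_j / (-𝒢_1)) δ_{(j-1)h}`. -/
def grunwaldJumpLaw (φ : Measure ℝ) (h : ℝ) : Measure ℝ :=
  Measure.sum fun j : {j : ℕ // j ≠ 1} =>
    ENNReal.ofReal (grunwaldCoeff φ h j / (-grunwaldCoeff φ h 1)) •
      Measure.dirac (((j : ℕ) - 1 : ℝ) * h)

/-- `Y` is the process `Y^h` started at `x`: the compound Poisson process with transition rate
`𝒢_j` from `y` to `y + (j-1)h` for each `j ≠ 1` and diagonal rate `𝒢_1`, i.e. which leaves each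
state at rate `-𝒢_1` and then moves by `(j-1)h` with probability `𝒢_j / (-𝒢_1)`. Its generator is
`f ↦ ∑_{j ≥ 0} 𝒢_j f(· + (j-1)h)`. -/
def IsGrunwaldProcess {Ω : Type*} [MeasurableSpace Ω] (P : Measure Ω) (Y : ℝ → Ω → ℝ)
    (φ : Measure ℝ) (h x : ℝ) : Prop :=
  IsCompoundPoisson P Y x (-grunwaldCoeff φ h 1) (grunwaldJumpLaw φ h)

/-! ### Path space and fast-forwarding

Paths are functions of `t : ℝ` of which only the values at times `t ≥ 0` matter. -/

/-- Right continuous on `[0,∞)` with left limits on `(0,∞)`. -/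
def IsCadlagPath (f : ℝ → ℝ) : Prop :=
  (∀ t, 0 ≤ t → ContinuousWithinAt f (Ici t) t) ∧
    ∀ t, 0 < t → ∃ l : ℝ, Tendsto f (𝓝[<] t) (𝓝 l)

/-- `D_{a,b}([0,∞), ℝ)`: the càdlàg paths that spend an infinite amount of time in `(a,b)`,
where `-∞ ≤ a < b ≤ ∞`. -/
def infiniteTimePaths (a b : EReal) : Set (ℝ → ℝ) :=
  {f | IsCadlagPath f ∧
    volume {t : ℝ | 0 ≤ t ∧ a < (f t : EReal) ∧ (f t : EReal) < b} = ⊤}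

/-- `A(t) = ∫_0^t 1_{f(z) ∈ B} dz`. -/
def occupationTime (f : ℝ → ℝ) (B : Set ℝ) (t : ℝ) : ℝ :=
  ∫ z in (0 : ℝ)..t, B.indicator (fun _ => (1 : ℝ)) (f z)

/-- `A⁻¹(t) = inf {s > 0 : A(s) > t}`. -/
def occupationInverse (f : ℝ → ℝ) (B : Set ℝ) (t : ℝ) : ℝ :=
  sInf {s : ℝ | 0 < s ∧ t < occupationTime f B s}

/-- The left fast-forwarding map at `a` (meaningful on `infiniteTimePaths a ⊤`): the time spent
in `(-∞, a]` is deleted. -/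
def leftFastForward (a : ℝ) (f : ℝ → ℝ) (t : ℝ) : ℝ :=
  f (occupationInverse f (Ioi a) t)

/-- The right fast-forwarding map at `b` (meaningful on `infiniteTimePaths ⊥ b`): the time spent
in `[b, ∞)` is deleted. -/
def rightFastForward (b : ℝ) (f : ℝ → ℝ) (t : ℝ) : ℝ :=
  f (occupationInverse f (Iio b) t)

/-- The time of the first jump (the first time away from the initial state) of a path that is
piecewise constant. -/
def firstJumpTime (f : ℝ → ℝ) : ℝ :=
  sInf {t : ℝ | 0 ≤ t ∧ f t ≠ f 0}

/-- The state on which a path lands at its first jump. -/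
def firstJumpState (f : ℝ → ℝ) : ℝ :=
  f (firstJumpTime f)

end

/-! Measured in units of `h` from its starting point, $Y^h$ is a walk on $\mathbb Z$ with
independent exponential holding times of rate $r=-\mathcal G_1$. Its steps are at least $-1$, the
step $-1$ has probability $p=\mathcal G_0/r$, and the mean step is zero because $\sum_j(j-1)\mathcal
G_j=0$. Fast-forwarding hides one side of the origin, so the new path leaves its initial state when
the walk first enters the visible side away from $0$, and its first jump time is the total holding
time at $0$ until then. This is a geometric sum of exponential times; its rate is $pr=\mathcal G_0$.

Recurrence is proved without hitting-time theory. The expected product of monotone weights in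
$[0,1]$ along the walk decreases to a bounded monotone subharmonic limit. A zero-mean walk makes
such a function harmonic, since its mean increments sum to zero over $\mathbb Z$
(`harmonic_of_subharmonic`); hence the limit vanishes wherever the weight is below $1$. With weights
$r/(r+1)$ on a half-line this gives infinite occupation time (`ae_tendsto_occupation`), with
indicator weights it gives almost sure exit (`ae_exists_exit`).

On the right, the walk can leave $[0,\infty)$ only onto $-1$, and a martingale gives the
characteristic function of the clock (`hasLaw_walkExit_Ici`). On the left, the Green function of the
walk killed on leaving $(-\infty,0]$ is constant: the constant solves the balance equation because
no step is below $-1$, and the error of the partial sums is bounded by a survival probability that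
tends to zero (`norm_sub_exitGreen_le`). Hence the walk exits at $x>0$ with probability
$\mu[x,\infty)/p$, and the same computation weighted by $e^{i\theta T}$ gives the law of the clock
$T$ (`measureReal_exit_Iic`, `hasLaw_walkExit_Iic`). A pathwise computation carries this back to
$Y^h$ (`gridPath_fastForward`). -/

/-! ### Grünwald coefficients: integral formula, signs and the zero-mean identity. -/

/-- The integrands of the Grünwald coefficients, as functions of `u = y / h`. -/
noncomputable def grunwaldKernel : ℕ → ℝ → ℝ
  | 0, u => Real.exp (-u) - 1 + u
  | 1, u => u * Real.exp (-u) - u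
  | j + 2, u => u ^ (j + 2) / ((j + 2).factorial : ℝ) * Real.exp (-u)

lemma continuous_grunwaldKernel (j : ℕ) : Continuous (grunwaldKernel j) := by
  match j with
  | 0 => unfold grunwaldKernel; fun_prop
  | 1 => unfold grunwaldKernel; fun_prop
  | j + 2 => unfold grunwaldKernel; fun_prop

lemma exp_neg_le_inv_one_add {u : ℝ} (hu : 0 ≤ u) : Real.exp (-u) ≤ (1 + u)⁻¹ := by
  rw [Real.exp_neg]
  exact inv_anti₀ (by positivity) (by linarith [Real.add_one_le_exp u])

lemma grunwaldKernel_zero_nonneg (u : ℝ) : 0 ≤ grunwaldKernel 0 u := by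
  have := Real.add_one_le_exp (-u)
  simp only [grunwaldKernel]; linarith

lemma grunwaldKernel_zero_pos {u : ℝ} (hu : 0 < u) : 0 < grunwaldKernel 0 u := by
  have := Real.add_one_lt_exp (x := -u) (by linarith)
  simp only [grunwaldKernel]; linarith

lemma grunwaldKernel_zero_le {u : ℝ} (hu : 0 ≤ u) : grunwaldKernel 0 u ≤ min (u ^ 2) u := by
  have h1 := exp_neg_le_inv_one_add hu
  have h2 : (1 + u)⁻¹ = 1 - u + u ^ 2 / (1 + u) := by field_simp; ring
  have h3 : u ^ 2 / (1 + u) ≤ u ^ 2 := div_le_self (by positivity) (by linarith)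
  have h4 : u ^ 2 / (1 + u) ≤ u := by rw [div_le_iff₀ (by positivity)]; nlinarith
  simp only [grunwaldKernel, le_min_iff]
  constructor <;> linarith

lemma grunwaldKernel_one_neg {u : ℝ} (hu : 0 < u) : grunwaldKernel 1 u < 0 := by
  have : Real.exp (-u) < 1 := by simpa using hu
  simp only [grunwaldKernel]; nlinarith

lemma neg_grunwaldKernel_one_le {u : ℝ} (hu : 0 ≤ u) : -grunwaldKernel 1 u ≤ min (u ^ 2) u := by
  have h1 := Real.add_one_le_exp (-u)
  have h2 := Real.exp_pos (-u)
  simp only [grunwaldKernel, le_min_iff]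
  constructor <;> nlinarith

lemma grunwaldKernel_add_two_pos (j : ℕ) {u : ℝ} (hu : 0 < u) : 0 < grunwaldKernel (j + 2) u := by
  simp only [grunwaldKernel]; positivity

/-- Expand $e^{-u}e^{uz}$ in $z$; the affine part $-1+(1-z)u$ changes only the coefficients of $z^0$
and $z^1$, which is why the kernel has two special cases. -/
lemma hasSum_grunwaldKernel_pow (u : ℝ) (z : ℂ) :
    HasSum (fun j => (grunwaldKernel j u : ℂ) * z ^ j)
      (Complex.exp (-(1 - z) * u) - 1 + (1 - z) * u) := by
  have h1 : HasSum (fun j : ℕ => Complex.exp (-u) * ((u * z) ^ j / (j.factorial : ℂ)))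
      (Complex.exp (-u) * Complex.exp (u * z)) := by
    rw [Complex.exp_eq_exp_ℂ]
    exact (NormedSpace.expSeries_div_hasSum_exp (u * z : ℂ)).mul_left _
  rw [← Complex.exp_add, ← hasSum_nat_add_iff' 2] at h1
  rw [← hasSum_nat_add_iff' 2]
  convert! h1 using 1
  · ext j
    simp only [grunwaldKernel]
    push_cast
    ring
  · simp only [Finset.sum_range_succ, Finset.sum_range_zero, grunwaldKernel]
    push_cast
    simp only [pow_zero, pow_one, Nat.factorial]
    rw [show -(1 - z) * (u : ℂ) = -u + u * z by ring]
    push_cast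
    ring

/-- The integrand form of $\sum_j(j-1)\mathcal G_j=0$. For a Poisson variable $N$ of mean $u$,
$E[N-1]=u-1$; moving the term $N=0$ across leaves $u-1+e^{-u}$. -/
lemma hasSum_mul_grunwaldKernel (u : ℝ) :
    HasSum (fun j : ℕ => ((j : ℝ) + 1) * grunwaldKernel (j + 2) u) (grunwaldKernel 0 u) := by
  have h0 : HasSum (fun j : ℕ => u ^ j / (j.factorial : ℝ)) (Real.exp u) := by
    rw [Real.exp_eq_exp_ℝ]
    exact NormedSpace.expSeries_div_hasSum_exp u
  have h1 : HasSum (fun j : ℕ => u * (u ^ (j + 1) / ((j + 1).factorial : ℝ)))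
      (u * (Real.exp u - 1)) := by
    refine HasSum.mul_left u ?_
    have := (hasSum_nat_add_iff' 1).2 h0
    simpa using this
  have h2 : HasSum (fun j : ℕ => u ^ (j + 2) / ((j + 2).factorial : ℝ)) (Real.exp u - (1 + u)) := by
    have := (hasSum_nat_add_iff' 2).2 h0
    simpa [Finset.sum_range_succ] using this
  convert! (h1.sub h2).mul_right (Real.exp (-u)) using 1
  · ext j
    simp only [grunwaldKernel, ← mul_assoc]
    congr 1
    have : ((j + 2).factorial : ℝ) = (j + 2) * ((j + 1).factorial : ℝ) := by
      rw [Nat.factorial_succ]; push_cast; ring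
    rw [this]
    have h3 : ((j + 1).factorial : ℝ) ≠ 0 := by positivity
    field_simp
    ring
  · have : Real.exp u * Real.exp (-u) = 1 := by rw [← Real.exp_add]; simp
    simp only [grunwaldKernel]
    linear_combination (1 - u) * this

/-- A single term of the preceding nonnegative series, with factor $j+1\ge1$. The bound is uniform
in $j$, so kernel $0$ dominates all kernels of index at least $2$. -/
lemma grunwaldKernel_add_two_le (j : ℕ) {u : ℝ} (hu : 0 < u) :
    grunwaldKernel (j + 2) u ≤ grunwaldKernel 0 u := by
  have h := le_hasSum (hasSum_mul_grunwaldKernel u) j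
    (fun i _ => mul_nonneg (by positivity) (grunwaldKernel_add_two_pos i hu).le)
  have := (grunwaldKernel_add_two_pos j hu).le
  nlinarith [(Nat.cast_nonneg j : (0 : ℝ) ≤ j)]

section
variable {φ : Measure ℝ} {h : ℝ}

lemma AdmissibleLevyMeasure.integrable_min (hφ : AdmissibleLevyMeasure φ) :
    Integrable (fun y : ℝ => min (y ^ 2) y) (φ.restrict (Ioi 0)) := by
  refine ⟨by fun_prop, ?_⟩
  rw [hasFiniteIntegral_iff_ofReal]
  · exact hφ.lintegral_lt_top
  · filter_upwards [ae_restrict_mem measurableSet_Ioi] with y hy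
    exact le_min (sq_nonneg y) (le_of_lt hy)

lemma AdmissibleLevyMeasure.integrable_min_div (hφ : AdmissibleLevyMeasure φ) (hh : 0 < h) :
    Integrable (fun y : ℝ => min ((y / h) ^ 2) (y / h)) (φ.restrict (Ioi 0)) := by
  refine (hφ.integrable_min.const_mul ((h ^ 2)⁻¹ + h⁻¹)).mono' (by fun_prop) ?_
  filter_upwards [ae_restrict_mem measurableSet_Ioi] with y hy
  have hy : 0 < y := hy
  have h1 : 0 < (h ^ 2)⁻¹ := by positivity
  have h2 : 0 < h⁻¹ := by positivity
  rw [Real.norm_of_nonneg (by positivity)]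
  rcases le_total (y ^ 2) y with hc | hc
  · rw [min_eq_left hc]
    refine (min_le_left _ _).trans ?_
    rw [div_pow, div_eq_inv_mul]
    have := sq_nonneg y
    nlinarith
  · rw [min_eq_right hc]
    refine (min_le_right _ _).trans ?_
    rw [div_eq_inv_mul]
    nlinarith

lemma AdmissibleLevyMeasure.integrable_grunwaldKernel (hφ : AdmissibleLevyMeasure φ) (hh : 0 < h)
    (j : ℕ) : Integrable (fun y : ℝ => grunwaldKernel j (y / h)) (φ.restrict (Ioi 0)) := by
  have hm (j : ℕ) : AEStronglyMeasurable (fun y : ℝ => grunwaldKernel j (y / h))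
      (φ.restrict (Ioi 0)) :=
    ((continuous_grunwaldKernel j).comp (continuous_id.div_const h)).aestronglyMeasurable
  refine (hφ.integrable_min_div hh).mono' (hm j) ?_
  filter_upwards [ae_restrict_mem measurableSet_Ioi] with y hy
  have hu : 0 < y / h := div_pos hy hh
  match j with
  | 0 =>
    rw [Real.norm_of_nonneg (grunwaldKernel_zero_nonneg _)]
    exact grunwaldKernel_zero_le hu.le
  | 1 =>
    rw [Real.norm_of_nonpos (grunwaldKernel_one_neg hu).le]
    exact neg_grunwaldKernel_one_le hu.le
  | j + 2 =>
    rw [Real.norm_of_nonneg (grunwaldKernel_add_two_pos j hu).le]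
    exact (grunwaldKernel_add_two_le j hu).trans (grunwaldKernel_zero_le hu.le)

/-- The divergence of $\int_{(0,1)}y\,\phi(dy)$ enters only here, to rule out $\phi=0$ on
$(0,\infty)$; strict signs of the coefficients follow. -/
lemma AdmissibleLevyMeasure.restrict_pos (hφ : AdmissibleLevyMeasure φ) : 0 < φ (Ioi 0) := by
  rw [pos_iff_ne_zero]
  intro h0
  have h1 : φ.restrict (Ioo (0 : ℝ) 1) = 0 := by
    rw [Measure.restrict_eq_zero]
    exact measure_mono_null Ioo_subset_Ioi_self h0
  have := hφ.lintegral_eq_top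
  rw [h1] at this
  simp at this

lemma AdmissibleLevyMeasure.integral_pos (hφ : AdmissibleLevyMeasure φ) {f : ℝ → ℝ}
    (hf : ∀ y, 0 < y → 0 < f y) (hi : Integrable f (φ.restrict (Ioi 0))) :
    0 < ∫ y in Ioi (0 : ℝ), f y ∂φ := by
  rw [setIntegral_pos_iff_support_of_nonneg_ae _ hi]
  · refine hφ.restrict_pos.trans_le (measure_mono fun y hy => ⟨?_, hy⟩)
    exact (hf y hy).ne'
  · filter_upwards [ae_restrict_mem measurableSet_Ioi] with y hy
    exact (hf y hy).le

lemma AdmissibleLevyMeasure.hasSum_laplaceExponent (hφ : AdmissibleLevyMeasure φ) (hh : 0 < h)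
    {z : ℂ} (hz : ‖z‖ < 1) :
    HasSum (fun j => ((∫ y in Ioi (0 : ℝ), grunwaldKernel j (y / h) ∂φ : ℝ) : ℂ) * z ^ j)
      (laplaceExponent φ ((1 - z) / h)) := by
  have hint (j : ℕ) : Integrable (fun y : ℝ => (grunwaldKernel j (y / h) : ℂ) * z ^ j)
      (φ.restrict (Ioi 0)) := (hφ.integrable_grunwaldKernel hh j).ofReal.mul_const _
  have hs : Summable fun j => ∫ y in Ioi (0 : ℝ), ‖(grunwaldKernel j (y / h) : ℂ) * z ^ j‖ ∂φ := by
    rw [← summable_nat_add_iff 2]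
    refine Summable.of_nonneg_of_le (fun j => integral_nonneg fun _ => norm_nonneg _)
      (f := fun j => (∫ y in Ioi (0 : ℝ), grunwaldKernel 0 (y / h) ∂φ) * ‖z‖ ^ (j + 2)) ?_ ?_
    · intro j
      rw [← integral_mul_const]
      refine integral_mono_ae (hint _).norm ((hφ.integrable_grunwaldKernel hh 0).mul_const _) ?_
      filter_upwards [ae_restrict_mem measurableSet_Ioi] with y hy
      have hu : 0 < y / h := div_pos hy hh
      rw [norm_mul, norm_pow, Complex.norm_real,
        Real.norm_of_nonneg (grunwaldKernel_add_two_pos j hu).le]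
      gcongr
      exact grunwaldKernel_add_two_le j hu
    · exact ((summable_nat_add_iff 2).2 (summable_geometric_of_lt_one (norm_nonneg z) hz)).mul_left _
  convert! hasSum_integral_of_summable_integral_norm hint hs using 1
  · ext j
    rw [integral_mul_const]
    exact congrArg (· * z ^ j) integral_complex_ofReal.symm
  · unfold laplaceExponent
    congr 1
    ext y
    rw [(hasSum_grunwaldKernel_pow (y / h) z).tsum_eq]
    push_cast
    rw [neg_mul, neg_mul, div_mul_eq_mul_div, mul_div_assoc]

/-- Uniqueness of power series: the integrated kernels and the Taylor coefficients represent the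
same function near $0$. -/
lemma AdmissibleLevyMeasure.grunwaldCoeff_eq (hφ : AdmissibleLevyMeasure φ) (hh : 0 < h) (j : ℕ) :
    grunwaldCoeff φ h j = ∫ y in Ioi (0 : ℝ), grunwaldKernel j (y / h) ∂φ := by
  set a : ℕ → ℂ := fun j => ((∫ y in Ioi (0 : ℝ), grunwaldKernel j (y / h) ∂φ : ℝ) : ℂ)
  have hp : HasFPowerSeriesAt (fun ξ : ℂ => laplaceExponent φ ((1 - ξ) / (h : ℂ)))
      (FormalMultilinearSeries.ofScalars ℂ a) 0 := by
    rw [hasFPowerSeriesAt_iff]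
    filter_upwards [Metric.ball_mem_nhds (0 : ℂ) one_pos] with z hz
    rw [mem_ball_zero_iff] at hz
    simpa [FormalMultilinearSeries.coeff_ofScalars, mul_comm, a] using
      hφ.hasSum_laplaceExponent hh hz
  have h1 := hp.eq_formalMultilinearSeries hp.analyticAt.hasFPowerSeriesAt
  have h2 := congrArg (fun p => p.coeff j) h1
  simp only [FormalMultilinearSeries.coeff_ofScalars] at h2
  rw [grunwaldCoeff, ← h2]
  simp [a]

lemma AdmissibleLevyMeasure.grunwaldCoeff_zero_pos (hφ : AdmissibleLevyMeasure φ) (hh : 0 < h) :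
    0 < grunwaldCoeff φ h 0 := by
  rw [hφ.grunwaldCoeff_eq hh]
  exact hφ.integral_pos (fun y hy => grunwaldKernel_zero_pos (div_pos hy hh))
    (hφ.integrable_grunwaldKernel hh 0)

lemma AdmissibleLevyMeasure.grunwaldCoeff_one_neg (hφ : AdmissibleLevyMeasure φ) (hh : 0 < h) :
    grunwaldCoeff φ h 1 < 0 := by
  rw [hφ.grunwaldCoeff_eq hh, ← neg_pos, ← integral_neg]
  exact hφ.integral_pos (fun y hy => neg_pos.2 (grunwaldKernel_one_neg (div_pos hy hh)))
    (hφ.integrable_grunwaldKernel hh 1).neg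

lemma AdmissibleLevyMeasure.grunwaldCoeff_add_two_pos (hφ : AdmissibleLevyMeasure φ) (hh : 0 < h)
    (j : ℕ) : 0 < grunwaldCoeff φ h (j + 2) := by
  rw [hφ.grunwaldCoeff_eq hh]
  exact hφ.integral_pos (fun y hy => grunwaldKernel_add_two_pos j (div_pos hy hh))
    (hφ.integrable_grunwaldKernel hh _)

lemma AdmissibleLevyMeasure.hasSum_mul_grunwaldCoeff (hφ : AdmissibleLevyMeasure φ) (hh : 0 < h) :
    HasSum (fun j : ℕ => ((j : ℝ) + 1) * grunwaldCoeff φ h (j + 2)) (grunwaldCoeff φ h 0) := by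
  have hint (j : ℕ) : Integrable (fun y : ℝ => ((j : ℝ) + 1) * grunwaldKernel (j + 2) (y / h))
      (φ.restrict (Ioi 0)) := (hφ.integrable_grunwaldKernel hh _).const_mul _
  have hpos (j : ℕ) : ∀ᵐ y ∂φ.restrict (Ioi 0),
      0 ≤ ((j : ℝ) + 1) * grunwaldKernel (j + 2) (y / h) := by
    filter_upwards [ae_restrict_mem measurableSet_Ioi] with y hy
    exact mul_nonneg (by positivity) (grunwaldKernel_add_two_pos j (div_pos hy hh)).le
  have hs : Summable fun j : ℕ =>
      ∫ y in Ioi (0 : ℝ), ‖((j : ℝ) + 1) * grunwaldKernel (j + 2) (y / h)‖ ∂φ := by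
    -- By nonnegativity, finite partial sums of the integrands stay below kernel $0$, so its
    -- integral bounds all partial sums of norms.
    refine summable_of_sum_le (c := ∫ y in Ioi (0 : ℝ), grunwaldKernel 0 (y / h) ∂φ)
      (fun j => integral_nonneg fun _ => norm_nonneg _) fun s => ?_
    rw [← integral_finsetSum _ fun j _ => (hint j).norm]
    refine integral_mono_ae (integrable_finsetSum _ fun j _ => (hint j).norm)
      (hφ.integrable_grunwaldKernel hh 0) ?_
    filter_upwards [ae_all_iff.2 hpos] with y hy
    rw [Finset.sum_congr rfl fun j _ => Real.norm_of_nonneg (hy j)]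
    exact sum_le_hasSum s (fun j _ => hy j) (hasSum_mul_grunwaldKernel (y / h))
  convert! hasSum_integral_of_summable_integral_norm hint hs using 1
  · ext j
    rw [integral_const_mul, hφ.grunwaldCoeff_eq hh]
  · rw [hφ.grunwaldCoeff_eq hh]
    congr 1
    ext y
    exact (hasSum_mul_grunwaldKernel (y / h)).tsum_eq.symm

end

/-! ### Zero-mean walks on the integers: harmonicity and vanishing survival weights. -/

section
variable {μ : Measure ℤ} [IsProbabilityMeasure μ]

lemma integrable_int_of_bound {E : Type*} [NormedAddCommGroup E] [SecondCountableTopology E]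
    (f : ℤ → E) (C : ℝ) (hf : ∀ k, ‖f k‖ ≤ C) : Integrable f μ :=
  Integrable.of_bound (StronglyMeasurable.of_discrete).aestronglyMeasurable C (ae_of_all _ hf)

/-- The sum of the increments `f (x + k) - f x` over `-N ≤ x < N`. -/
def windowIncrement (f : ℤ → ℝ) (N : ℕ) (k : ℤ) : ℝ :=
  ∑ i ∈ Finset.range (2 * N), (f ((i : ℤ) - N + k) - f ((i : ℤ) - N))

lemma windowIncrement_zero (f : ℤ → ℝ) (N : ℕ) : windowIncrement f N 0 = 0 := by
  simp [windowIncrement]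

/-- Shifting by one telescopes over the window and leaves its two boundary values. Induction on `k`
in both directions then gives a bound linear in $|k|$, uniform in `N`, and the limit $k(b-a)$. -/
lemma windowIncrement_add_one (f : ℤ → ℝ) (N : ℕ) (k : ℤ) :
    windowIncrement f N (k + 1) = windowIncrement f N k + (f (N + k) - f (-N + k)) := by
  have := Finset.sum_range_sub (fun i : ℕ => f ((i : ℤ) - N + k)) (2 * N)
  rw [windowIncrement, windowIncrement]
  rw [show f (N + k) - f (-N + k) = f (((2 * N : ℕ) : ℤ) - N + k) - f (((0 : ℕ) : ℤ) - N + k) by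
    push_cast; ring_nf, ← this, ← Finset.sum_add_distrib]
  refine Finset.sum_congr rfl fun i _ => ?_
  rw [show (i : ℤ) - N + (k + 1) = ((i + 1 : ℕ) : ℤ) - N + k by push_cast; ring]
  ring

lemma abs_windowIncrement_le {f : ℤ → ℝ} {C : ℝ} (hf : ∀ x, |f x| ≤ C) (N : ℕ) (k : ℤ) :
    |windowIncrement f N k| ≤ 2 * C * |(k : ℝ)| := by
  have hstep (x y : ℤ) : |f x - f y| ≤ 2 * C := by
    have := abs_sub (f x) (f y)
    linarith [hf x, hf y]
  induction k with
  | zero => simp [windowIncrement_zero]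
  | succ i hi =>
    rw [windowIncrement_add_one]
    refine (abs_add_le _ _).trans ?_
    have h1 : |((i : ℤ) : ℝ)| = i := by simp
    have h2 : |(((i : ℤ) + 1 : ℤ) : ℝ)| = i + 1 := by
      push_cast; exact abs_of_nonneg (by positivity)
    rw [h2]; rw [h1] at hi
    linarith [hstep (N + i) (-N + i)]
  | pred i hi =>
    have h := windowIncrement_add_one f N (-(i : ℤ) - 1)
    rw [sub_add_cancel] at h
    have h1 : |((-(i : ℤ) : ℤ) : ℝ)| = i := by simp
    have h2 : |((-(i : ℤ) - 1 : ℤ) : ℝ)| = i + 1 := by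
      push_cast; rw [abs_of_nonpos (by linarith [(Nat.cast_nonneg i : (0 : ℝ) ≤ i)])]; ring
    rw [h2]; rw [h1] at hi
    rw [eq_sub_of_add_eq h.symm]
    refine (abs_sub _ _).trans ?_
    linarith [hstep (N + (-(i : ℤ) - 1)) (-N + (-(i : ℤ) - 1))]

lemma tendsto_windowIncrement {f : ℤ → ℝ} {a b : ℝ} (ha : Tendsto f atBot (𝓝 a))
    (hb : Tendsto f atTop (𝓝 b)) (k : ℤ) :
    Tendsto (fun N => windowIncrement f N k) atTop (𝓝 (k * (b - a))) := by
  have hstep (k : ℤ) : Tendsto (fun N : ℕ => f (N + k) - f (-N + k)) atTop (𝓝 (b - a)) := by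
    refine (hb.comp ?_).sub (ha.comp ?_)
    · exact tendsto_atTop_add_const_right _ _ tendsto_natCast_atTop_atTop
    · exact tendsto_atBot_add_const_right _ _
        (tendsto_neg_atTop_atBot.comp tendsto_natCast_atTop_atTop)
  induction k with
  | zero => simp [windowIncrement_zero]
  | succ i hi =>
    simp_rw [windowIncrement_add_one]
    convert! hi.add (hstep i) using 2
    push_cast; ring
  | pred i hi =>
    have h (N : ℕ) := windowIncrement_add_one f N (-(i : ℤ) - 1)
    simp_rw [sub_add_cancel] at h
    simp_rw [fun N => eq_sub_of_add_eq (h N).symm]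
    convert! hi.sub (hstep (-(i : ℤ) - 1)) using 2
    push_cast; ring

/-- A mean zero step does not increase a bounded function with limits at both ends, when summed
over all of `ℤ`. -/
lemma tendsto_sum_mean_increment (hμ : Integrable (fun k : ℤ => (k : ℝ)) μ)
    (h0 : ∫ k : ℤ, (k : ℝ) ∂μ = 0) {f : ℤ → ℝ} {a b C : ℝ} (hf : ∀ x, |f x| ≤ C)
    (ha : Tendsto f atBot (𝓝 a)) (hb : Tendsto f atTop (𝓝 b)) :
    Tendsto (fun N : ℕ => ∑ i ∈ Finset.range (2 * N),
      ((∫ k, f ((i : ℤ) - N + k) ∂μ) - f ((i : ℤ) - N))) atTop (𝓝 0) := by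
  have h1 : Tendsto (fun N => ∫ k, windowIncrement f N k ∂μ) atTop
      (𝓝 (∫ k : ℤ, (k : ℝ) * (b - a) ∂μ)) := by
    refine tendsto_integral_of_dominated_convergence (fun k => 2 * C * |(k : ℝ)|)
      (fun N => (StronglyMeasurable.of_discrete).aestronglyMeasurable) (hμ.abs.const_mul _)
      (fun N => ae_of_all _ fun k => abs_windowIncrement_le hf N k)
      (ae_of_all _ fun k => tendsto_windowIncrement ha hb k)
  rw [integral_mul_const, h0, zero_mul] at h1
  refine h1.congr fun N => ?_
  have hi (x : ℤ) : Integrable (fun k => f (x + k)) μ :=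
    integrable_int_of_bound _ C fun k => hf _
  unfold windowIncrement
  refine (integral_finsetSum _ fun i _ => (hi _).sub (integrable_const _)).trans ?_
  refine Finset.sum_congr rfl fun i _ => ?_
  refine (integral_sub (hi _) (integrable_const _)).trans ?_
  simp

/-- A bounded monotone or antitone function which is subharmonic for a mean zero walk is
harmonic. -/
lemma harmonic_of_subharmonic (hμ : Integrable (fun k : ℤ => (k : ℝ)) μ)
    (h0 : ∫ k : ℤ, (k : ℝ) ∂μ = 0) {f : ℤ → ℝ} {C : ℝ} (hf : ∀ x, |f x| ≤ C)
    (hmono : Monotone f ∨ Antitone f) (hsub : ∀ x, f x ≤ ∫ k, f (x + k) ∂μ) (x : ℤ) :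
    ∫ k, f (x + k) ∂μ = f x := by
  have hbdd : BddAbove (range f) ∧ BddBelow (range f) :=
    ⟨⟨C, by rintro _ ⟨y, rfl⟩; exact (abs_le.1 (hf y)).2⟩,
      ⟨-C, by rintro _ ⟨y, rfl⟩; exact (abs_le.1 (hf y)).1⟩⟩
  obtain ⟨a, b, ha, hb⟩ : ∃ a b, Tendsto f atBot (𝓝 a) ∧ Tendsto f atTop (𝓝 b) := by
    rcases hmono with h | h
    · exact ⟨_, _, tendsto_atBot_ciInf h hbdd.2, tendsto_atTop_ciSup h hbdd.1⟩
    · exact ⟨_, _, tendsto_atBot_ciSup h hbdd.1, tendsto_atTop_ciInf h hbdd.2⟩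
  have ht := tendsto_sum_mean_increment hμ h0 hf ha hb
  refine le_antisymm ?_ (hsub x)
  rw [← sub_nonpos]
  -- The window sums have nonnegative terms and tend to $0$, and `x` lies in every window with
  -- $N>|x|$, so its own term is at most $0$.
  refine ge_of_tendsto ht ?_
  filter_upwards [eventually_gt_atTop x.natAbs] with N hN
  have hmem : (x + N).toNat ∈ Finset.range (2 * N) := by
    rw [Finset.mem_range]; omega
  have hcast : (((x + N).toNat : ℕ) : ℤ) - N = x := by omega
  have := Finset.single_le_sum (f := fun i : ℕ => (∫ k, f ((i : ℤ) - N + k) ∂μ) - f ((i : ℤ) - N))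
    (fun i _ => sub_nonneg.2 (hsub _)) hmem
  simpa only [hcast] using this

/-- The expected product of the weights `w` at the first `n` positions of the walk with step law
`μ` started at `x`. -/
noncomputable def walkWeight (μ : Measure ℤ) (w : ℤ → ℝ) : ℕ → ℤ → ℝ
  | 0, _ => 1
  | n + 1, x => w x * ∫ k, walkWeight μ w n (x + k) ∂μ

variable {w : ℤ → ℝ}

lemma walkWeight_mem (hw : ∀ x, w x ∈ Icc (0 : ℝ) 1) (n : ℕ) (x : ℤ) :
    walkWeight μ w n x ∈ Icc (0 : ℝ) 1 := by
  induction n generalizing x with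
  | zero => simp [walkWeight]
  | succ n ih =>
    have h1 : 0 ≤ ∫ k, walkWeight μ w n (x + k) ∂μ := integral_nonneg fun k => (ih _).1
    have h2 : ∫ k, walkWeight μ w n (x + k) ∂μ ≤ 1 := by
      have := integral_mono (μ := μ) (f := fun k => walkWeight μ w n (x + k)) (g := fun _ => 1)
        (integrable_int_of_bound _ 1 fun k => by
          rw [Real.norm_of_nonneg (ih _).1]; exact (ih _).2)
        (integrable_const _) fun k => (ih _).2
      simpa using this
    exact ⟨mul_nonneg (hw x).1 h1, mul_le_one₀ (hw x).2 h1 h2⟩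

lemma integrable_walkWeight (hw : ∀ x, w x ∈ Icc (0 : ℝ) 1) (n : ℕ) (g : ℤ → ℤ) :
    Integrable (fun k => walkWeight μ w n (g k)) μ :=
  integrable_int_of_bound _ 1 fun k => by
    rw [Real.norm_of_nonneg (walkWeight_mem hw _ _).1]; exact (walkWeight_mem hw _ _).2

lemma walkWeight_succ_le (hw : ∀ x, w x ∈ Icc (0 : ℝ) 1) (n : ℕ) (x : ℤ) :
    walkWeight μ w (n + 1) x ≤ walkWeight μ w n x := by
  induction n generalizing x with
  | zero => exact (walkWeight_mem hw 1 x).2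
  | succ n ih =>
    exact mul_le_mul_of_nonneg_left (integral_mono (integrable_walkWeight hw _ _)
      (integrable_walkWeight hw _ _) fun k => ih _) (hw x).1

lemma walkWeight_monotone (hw : ∀ x, w x ∈ Icc (0 : ℝ) 1) (hm : Monotone w) (n : ℕ) :
    Monotone (walkWeight μ w n) := by
  induction n with
  | zero => exact fun _ _ _ => le_rfl
  | succ n ih =>
    exact fun x y hxy => mul_le_mul (hm hxy) (integral_mono (integrable_walkWeight hw _ _)
      (integrable_walkWeight hw _ _) fun k => ih (by linarith))
      (integral_nonneg fun k => (walkWeight_mem hw _ _).1) (hw y).1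

lemma walkWeight_antitone (hw : ∀ x, w x ∈ Icc (0 : ℝ) 1) (hm : Antitone w) (n : ℕ) :
    Antitone (walkWeight μ w n) := by
  induction n with
  | zero => exact fun _ _ _ => le_rfl
  | succ n ih =>
    exact fun x y hxy => mul_le_mul (hm hxy) (integral_mono (integrable_walkWeight hw _ _)
      (integrable_walkWeight hw _ _) fun k => ih (by linarith))
      (integral_nonneg fun k => (walkWeight_mem hw _ _).1) (hw x).1

/-- The decreasing limit satisfies $L=w\cdot\mu L\le\mu L$, so it is subharmonic, and it inherits
monotonicity from `w`; therefore $\mu L=L$. Where $w<1$, the equation $\mu L=w\cdot\mu L$ forces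
$\mu L=0$. -/
lemma exists_tendsto_walkWeight (hμ : Integrable (fun k : ℤ => (k : ℝ)) μ)
    (h0 : ∫ k : ℤ, (k : ℝ) ∂μ = 0) (hw : ∀ x, w x ∈ Icc (0 : ℝ) 1)
    (hmono : Monotone w ∨ Antitone w) :
    ∃ L : ℤ → ℝ, (∀ x, Tendsto (fun n => walkWeight μ w n x) atTop (𝓝 (L x))) ∧
      (∀ x, L x ∈ Icc (0 : ℝ) 1) ∧ (∀ x, L x = w x * ∫ k, L (x + k) ∂μ) ∧
      ∀ x, w x < 1 → ∫ k, L (x + k) ∂μ = 0 := by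
  set L : ℤ → ℝ := fun x => ⨅ n, walkWeight μ w n x
  have hL (x : ℤ) : Tendsto (fun n => walkWeight μ w n x) atTop (𝓝 (L x)) :=
    tendsto_atTop_ciInf (antitone_nat_of_succ_le fun n => walkWeight_succ_le hw n x)
      ⟨0, by rintro _ ⟨n, rfl⟩; exact (walkWeight_mem hw n x).1⟩
  have hmem (x : ℤ) : L x ∈ Icc (0 : ℝ) 1 :=
    isClosed_Icc.mem_of_tendsto (hL x) (Eventually.of_forall fun n => walkWeight_mem hw n x)
  have hfix (x : ℤ) : L x = w x * ∫ k, L (x + k) ∂μ := by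
    refine tendsto_nhds_unique ((tendsto_add_atTop_iff_nat 1).2 (hL x)) ?_
    refine Tendsto.const_mul _ ?_
    refine tendsto_integral_of_dominated_convergence (fun _ => (1 : ℝ))
      (fun n => (integrable_walkWeight hw n _).aestronglyMeasurable) (integrable_const _)
      (fun n => ae_of_all _ fun k => ?_) (ae_of_all _ fun k => hL _)
    rw [Real.norm_of_nonneg (walkWeight_mem hw _ _).1]
    exact (walkWeight_mem hw _ _).2
  have hint (x : ℤ) : 0 ≤ ∫ k, L (x + k) ∂μ := integral_nonneg fun k => (hmem _).1
  refine ⟨L, hL, hmem, hfix, fun x hx => ?_⟩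
  have hharm : ∫ k, L (x + k) ∂μ = L x := by
    refine harmonic_of_subharmonic hμ h0 (C := 1) (fun x => ?_) ?_ (fun x => ?_) x
    · rw [abs_of_nonneg (hmem x).1]; exact (hmem x).2
    · rcases hmono with h | h
      · exact Or.inl fun x y hxy => le_of_tendsto_of_tendsto' (hL x) (hL y)
          fun n => walkWeight_monotone hw h n hxy
      · exact Or.inr fun x y hxy => le_of_tendsto_of_tendsto' (hL y) (hL x)
          fun n => walkWeight_antitone hw h n hxy
    · rw [hfix x]
      exact mul_le_of_le_one_left (hint x) (hw x).2
  have := hfix x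
  rw [← hharm] at this
  nlinarith [hint x]

/-- A mean zero walk started where it is discounted collects discounts for ever. -/
lemma tendsto_walkWeight_zero (hμ : Integrable (fun k : ℤ => (k : ℝ)) μ)
    (h0 : ∫ k : ℤ, (k : ℝ) ∂μ = 0) (hw : ∀ x, w x ∈ Icc (0 : ℝ) 1)
    (hmono : Monotone w ∨ Antitone w) {x : ℤ} (hx : w x < 1) :
    Tendsto (fun n => walkWeight μ w n x) atTop (𝓝 0) := by
  obtain ⟨L, hL, -, hfix, hz⟩ := exists_tendsto_walkWeight hμ h0 hw hmono
  have := hfix x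
  rw [hz x hx, mul_zero] at this
  rw [← this]; exact hL x

/-- This reaches starting points where the weight is $1$: the mean of the nonnegative limit over one
step from `x` is zero, so the limit vanishes at every point charged by that step. -/
lemma tendsto_walkWeight_zero_of_step (hμ : Integrable (fun k : ℤ => (k : ℝ)) μ)
    (h0 : ∫ k : ℤ, (k : ℝ) ∂μ = 0) (hw : ∀ x, w x ∈ Icc (0 : ℝ) 1)
    (hmono : Monotone w ∨ Antitone w) {x k : ℤ} (hx : w x < 1) (hk : μ {k} ≠ 0) :
    Tendsto (fun n => walkWeight μ w n (x + k)) atTop (𝓝 0) := by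
  obtain ⟨L, hL, hmem, -, hz⟩ := exists_tendsto_walkWeight hμ h0 hw hmono
  have h1 := (integral_eq_zero_iff_of_nonneg (μ := μ) (f := fun k => L (x + k))
    (fun k => (hmem _).1) (integrable_int_of_bound _ 1 fun k => by
      rw [Real.norm_of_nonneg (hmem _).1]; exact (hmem _).2)).1 (hz x hx)
  have h2 : L (x + k) = 0 := ae_iff_of_countable.1 h1 k hk
  rw [← h2]; exact hL _

end

/-! ### Transforms of the exponential law. -/

lemma integral_cexp_expMeasure {r : ℝ} (hr : 0 < r) {z : ℂ} (hz : z.re < r) :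
    ∫ x, Complex.exp (z * x) ∂(expMeasure r) = r / (r - z) := by
  have hpdf : Measurable (fun x => (exponentialPDFReal r x).toNNReal) :=
    (measurable_exponentialPDFReal r).real_toNNReal
  have h1 : expMeasure r = volume.withDensity
      fun x => (((exponentialPDFReal r x).toNNReal : NNReal) : ENNReal) := rfl
  rw [h1, integral_withDensity_eq_integral_smul hpdf]
  have h2 : (fun x : ℝ => (exponentialPDFReal r x).toNNReal • Complex.exp (z * x)) =
      (Ici (0 : ℝ)).indicator fun x => (r : ℂ) * Complex.exp ((z - r) * x) := by
    ext x
    rw [NNReal.smul_def, Real.coe_toNNReal _ (exponentialPDFReal_nonneg hr x)]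
    by_cases hx : 0 ≤ x
    · rw [indicator_of_mem (mem_Ici.2 hx)]
      simp only [exponentialPDFReal, gammaPDFReal, hx, if_true]
      simp only [Real.rpow_one, Real.Gamma_one, div_one, sub_self, Real.rpow_zero, mul_one,
        Complex.real_smul]
      push_cast
      rw [mul_assoc, ← Complex.exp_add]
      congr 2
      ring
    · rw [indicator_of_notMem (by simpa using hx)]
      simp [exponentialPDFReal, gammaPDFReal, hx]
  rw [h2, integral_indicator measurableSet_Ici, integral_Ici_eq_integral_Ioi, integral_const_mul,
    integral_exp_mul_complex_Ioi (by simpa using hz)]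
  have h3 : z - r ≠ 0 := fun h => by
    have := congrArg Complex.re h
    simp at this; linarith
  have h4 : (r : ℂ) - z ≠ 0 := fun h => h3 (by linear_combination -h)
  simp only [Complex.ofReal_zero, mul_zero, Complex.exp_zero]
  field_simp
  ring

lemma integral_exp_neg_expMeasure {r : ℝ} (hr : 0 < r) :
    ∫ x, Real.exp (-x) ∂(expMeasure r) = r / (r + 1) := by
  have h := integral_cexp_expMeasure hr (z := -1) (by simp; linarith)
  have h1 : ∫ x, Complex.exp (-1 * x) ∂(expMeasure r) =
      ((∫ x, Real.exp (-x) ∂(expMeasure r) : ℝ) : ℂ) := by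
    rw [← integral_complex_ofReal]
    congr 1; ext x; push_cast; simp
  rw [h1] at h
  have h2 : (r : ℂ) / (r - -1) = ((r / (r + 1) : ℝ) : ℂ) := by push_cast; ring
  rw [h2] at h
  exact_mod_cast h

lemma charFun_expMeasure {r : ℝ} (hr : 0 < r) (θ : ℝ) :
    charFun (expMeasure r) θ = r / (r - θ * Complex.I) := by
  rw [charFun_apply_real, ← integral_cexp_expMeasure hr (z := θ * Complex.I) (by simpa using hr)]
  congr 1; ext x; ring_nf

/-! ### The stopped walk with its clock, and its Markov property. -/

section
open scoped Classical in
/-- One step of the walk which runs while it is in `D`, together with a clock which runs while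
it is in `B`. -/
noncomputable def walkStep (B D : Set ℤ) (a : ℝ × ℤ) (z : ℝ × ℤ) : ℝ × ℤ :=
  if a.2 ∈ D then (a.1 + if a.2 ∈ B then z.1 else 0, a.2 + z.2) else a

lemma measurable_walkStep (B D : Set ℤ) :
    Measurable fun q : (ℝ × ℤ) × (ℝ × ℤ) => walkStep B D q.1 q.2 := by
  classical
  have hD : MeasurableSet {q : (ℝ × ℤ) × (ℝ × ℤ) | q.1.2 ∈ D} :=
    (MeasurableSet.of_discrete (s := D)).preimage (by fun_prop)
  have hB : MeasurableSet {q : (ℝ × ℤ) × (ℝ × ℤ) | q.1.2 ∈ B} :=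
    (MeasurableSet.of_discrete (s := B)).preimage (by fun_prop)
  refine Measurable.ite hD (Measurable.prodMk ?_ (by fun_prop)) (by fun_prop)
  exact Measurable.add (by fun_prop) (Measurable.ite hB (by fun_prop) (by fun_prop))

variable {Ω : Type*}

/-- The clock and the position of the stopped walk driven by `Z`, started at `0`. -/
noncomputable def walkChain (B D : Set ℤ) (Z : ℕ → Ω → ℝ × ℤ) : ℕ → Ω → ℝ × ℤ
  | 0, _ => (0, 0)
  | n + 1, ω => walkStep B D (walkChain B D Z n ω) (Z n ω)

/-- The clock and the position when the walk has left `D`. -/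
noncomputable def walkExit (B D : Set ℤ) (Z : ℕ → Ω → ℝ × ℤ) (ω : Ω) : ℝ × ℤ :=
  walkChain B D Z (sInf {n | (walkChain B D Z n ω).2 ∉ D}) ω

/-- The chain at time `n` depends only on the first `n` pairs, hence is independent of `Z n`. -/
lemma walkChain_eq_comp (B D : Set ℤ) (Z : ℕ → Ω → ℝ × ℤ) (n : ℕ) :
    ∃ g : (Finset.range n → ℝ × ℤ) → ℝ × ℤ, Measurable g ∧
      ∀ ω, walkChain B D Z n ω = g fun i => Z i ω := by
  induction n with
  | zero => exact ⟨fun _ => (0, 0), measurable_const, fun _ => rfl⟩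
  | succ n ih =>
    obtain ⟨g, hg, hgZ⟩ := ih
    refine ⟨fun y => walkStep B D
      (g fun i => y ⟨i, Finset.mem_range.2 ((Finset.mem_range.1 i.2).trans (Nat.lt_succ_self n))⟩)
      (y ⟨n, Finset.mem_range.2 (Nat.lt_succ_self n)⟩), ?_, fun ω => ?_⟩
    · refine (measurable_walkStep B D).comp (Measurable.prodMk (hg.comp ?_) (measurable_pi_apply _))
      exact measurable_pi_lambda _ fun i => measurable_pi_apply _
    · rw [walkChain, hgZ]

variable [MeasurableSpace Ω]

/-- Independent pairs of an exponential holding time and a step with law `μ`. -/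
structure IsWalkSequence (P : Measure Ω) (Z : ℕ → Ω → ℝ × ℤ) (r : ℝ) (μ : Measure ℤ) :
    Prop where
  measurable : ∀ n, Measurable (Z n)
  pos : ∀ n ω, 0 < (Z n ω).1
  map_eq : ∀ n, P.map (Z n) = (expMeasure r).prod μ
  indep : ∀ n, IndepFun (fun ω (i : Finset.range n) => Z i ω) (Z n) P

variable {P : Measure Ω} {Z : ℕ → Ω → ℝ × ℤ} {r : ℝ} {μ : Measure ℤ} {B D : Set ℤ}

namespace IsWalkSequence

lemma measurable_walkChain (hZ : IsWalkSequence P Z r μ) (n : ℕ) :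
    Measurable (walkChain B D Z n) := by
  induction n with
  | zero => exact measurable_const
  | succ n ih => exact (measurable_walkStep B D).comp (ih.prodMk (hZ.measurable n))

variable [IsProbabilityMeasure P]

lemma map_prodMk (hZ : IsWalkSequence P Z r μ) (n : ℕ) :
    P.map (fun ω => (walkChain B D Z n ω, Z n ω)) =
      (P.map (walkChain B D Z n)).prod ((expMeasure r).prod μ) := by
  have hi : IndepFun (walkChain B D Z n) (Z n) P := by
    obtain ⟨g, hg, hgZ⟩ := walkChain_eq_comp B D Z n
    have := (hZ.indep n).comp hg measurable_id
    convert! this using 1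
    ext1 ω; exact hgZ ω
  rw [(indepFun_iff_map_prod_eq_prod_map_map (hZ.measurable_walkChain n).aemeasurable
    (hZ.measurable n).aemeasurable).1 hi, hZ.map_eq]

variable {F : Type*} [NormedAddCommGroup F] [NormedSpace ℝ F]

/-- The Markov property of the walk. -/
lemma integral_succ (hZ : IsWalkSequence P Z r μ) (hr : 0 < r) (n : ℕ) {f : ℝ × ℤ → F}
    (hf : StronglyMeasurable f) (hi : Integrable (fun ω => f (walkChain B D Z (n + 1) ω)) P) :
    ∫ ω, f (walkChain B D Z (n + 1) ω) ∂P =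
      ∫ ω, (∫ x, (∫ k, f (walkStep B D (walkChain B D Z n ω) (x, k)) ∂μ) ∂(expMeasure r)) ∂P := by
  have := isProbabilityMeasure_expMeasure hr
  have := Measure.isProbabilityMeasure_map (μ := P)
    (hZ.measurable_walkChain (B := B) (D := D) n).aemeasurable
  have hm : Measurable fun ω => (walkChain B D Z n ω, Z n ω) :=
    (hZ.measurable_walkChain n).prodMk (hZ.measurable n)
  have hg : StronglyMeasurable fun q : (ℝ × ℤ) × (ℝ × ℤ) => f (walkStep B D q.1 q.2) :=
    hf.comp_measurable (measurable_walkStep B D)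
  have hi' : Integrable (fun q : (ℝ × ℤ) × (ℝ × ℤ) => f (walkStep B D q.1 q.2))
      ((P.map (walkChain B D Z n)).prod ((expMeasure r).prod μ)) := by
    rw [← hZ.map_prodMk n, integrable_map_measure hg.aestronglyMeasurable hm.aemeasurable]
    exact hi
  have h1 : ∫ ω, f (walkChain B D Z (n + 1) ω) ∂P =
      ∫ q, f (walkStep B D q.1 q.2) ∂(P.map fun ω => (walkChain B D Z n ω, Z n ω)) := by
    rw [integral_map hm.aemeasurable hg.aestronglyMeasurable]
    rfl
  rw [h1, hZ.map_prodMk, integral_prod _ hi']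
  have hae := (ae_map_iff (p := fun a => Integrable (fun z => f (walkStep B D a z))
    ((expMeasure r).prod μ)) (hZ.measurable_walkChain (B := B) (D := D) n).aemeasurable
    (measurableSet_integrable (f := fun a z => f (walkStep B D a z)) hg)).1 hi'.prod_right_ae
  rw [integral_map (hZ.measurable_walkChain n).aemeasurable
    hg.integral_prod_right'.aestronglyMeasurable]
  refine integral_congr_ae ?_
  filter_upwards [hae] with ω hω
  exact integral_prod _ hω

end IsWalkSequence
end

/-! ### Infinite occupation time and almost sure exit. -/

section
variable {Ω : Type*} {Z : ℕ → Ω → ℝ × ℤ} {B D : Set ℤ}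

lemma walkChain_fst_nonneg (hpos : ∀ n ω, 0 < (Z n ω).1) (n : ℕ) (ω : Ω) :
    0 ≤ (walkChain B D Z n ω).1 := by
  induction n with
  | zero => exact le_rfl
  | succ n ih =>
    simp only [walkChain, walkStep]
    split_ifs
    · exact add_nonneg ih (hpos n ω).le
    · simpa using ih
    · exact ih

lemma walkChain_fst_mono (hpos : ∀ n ω, 0 < (Z n ω).1) (ω : Ω) :
    Monotone fun n => (walkChain B D Z n ω).1 := by
  refine monotone_nat_of_le_succ fun n => ?_
  simp only [walkChain, walkStep]
  split_ifs
  · exact le_add_of_nonneg_right (hpos n ω).le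
  · simp
  · exact le_rfl

lemma walkChain_eq_of_exit {n m : ℕ} {ω : Ω} (hn : (walkChain B D Z n ω).2 ∉ D) (hm : n ≤ m) :
    walkChain B D Z m ω = walkChain B D Z n ω := by
  induction m, hm using Nat.le_induction with
  | base => rfl
  | succ m _ ih => rw [walkChain, ih, walkStep, if_neg hn]

lemma walkExit_snd_notMem {ω : Ω} (h : ∃ n, (walkChain B D Z n ω).2 ∉ D) :
    (walkExit B D Z ω).2 ∉ D :=
  Nat.sInf_mem (s := {n | (walkChain B D Z n ω).2 ∉ D}) h

lemma eventually_walkChain_eq_walkExit {ω : Ω} (h : ∃ n, (walkChain B D Z n ω).2 ∉ D) :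
    ∀ᶠ n in atTop, walkChain B D Z n ω = walkExit B D Z ω := by
  filter_upwards [eventually_ge_atTop (sInf {n | (walkChain B D Z n ω).2 ∉ D})] with n hn
  exact walkChain_eq_of_exit (walkExit_snd_notMem h) hn

variable [MeasurableSpace Ω] {P : Measure Ω} {r : ℝ} {μ : Measure ℤ}

namespace IsWalkSequence

lemma aemeasurable_walkExit (hZ : IsWalkSequence P Z r μ)
    (hexit : ∀ᵐ ω ∂P, ∃ n, (walkChain B D Z n ω).2 ∉ D) : AEMeasurable (walkExit B D Z) P := by
  refine aemeasurable_of_tendsto_metrizable_ae atTop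
    (fun n => (hZ.measurable_walkChain (B := B) (D := D) n).aemeasurable) ?_
  filter_upwards [hexit] with ω hω
  exact tendsto_nhds_of_eventually_eq (eventually_walkChain_eq_walkExit hω)

variable [IsProbabilityMeasure P]

lemma tendsto_integral_walkExit (hZ : IsWalkSequence P Z r μ)
    (hexit : ∀ᵐ ω ∂P, ∃ n, (walkChain B D Z n ω).2 ∉ D) {f : ℝ × ℤ → ℂ} (hf : Measurable f)
    {C : ℝ} (hC : ∀ a, ‖f a‖ ≤ C) :
    Tendsto (fun n => ∫ ω, f (walkChain B D Z n ω) ∂P) atTop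
      (𝓝 (∫ ω, f (walkExit B D Z ω) ∂P)) := by
  refine tendsto_integral_of_dominated_convergence (fun _ => C)
    (fun n => (hf.comp (hZ.measurable_walkChain n)).aestronglyMeasurable) (integrable_const _)
    (fun n => ae_of_all _ fun ω => hC _) ?_
  filter_upwards [hexit] with ω hω
  refine tendsto_nhds_of_eventually_eq ?_
  filter_upwards [eventually_walkChain_eq_walkExit hω] with n hn
  rw [hn]

variable [IsProbabilityMeasure μ]

-- One step of the chain is traded for one factor of the weight, because $r/(r+1)=E[e^{-\tau}]$ for
-- a holding time $\tau$ of rate $r$. For $m=0$ it is the Laplace transform of the clock at $1$.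
open scoped Classical in
lemma integral_exp_neg_walkChain (hZ : IsWalkSequence P Z r μ) (hr : 0 < r) (B : Set ℤ)
    (n m : ℕ) :
    ∫ ω, Real.exp (-(walkChain B univ Z n ω).1) *
      walkWeight μ (fun s => if s ∈ B then r / (r + 1) else 1) m (walkChain B univ Z n ω).2 ∂P =
    walkWeight μ (fun s => if s ∈ B then r / (r + 1) else 1) (n + m) 0 := by
  have := isProbabilityMeasure_expMeasure hr
  set w : ℤ → ℝ := fun s => if s ∈ B then r / (r + 1) else 1 with hw_def
  have hw (x : ℤ) : w x ∈ Icc (0 : ℝ) 1 := by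
    simp only [hw_def]
    split_ifs
    · exact ⟨by positivity, by rw [div_le_one (by positivity)]; linarith⟩
    · simp
  have hmeas (m : ℕ) : Measurable fun a : ℝ × ℤ => Real.exp (-a.1) * walkWeight μ w m a.2 :=
    (by fun_prop : Measurable fun a : ℝ × ℤ => Real.exp (-a.1)).mul
      ((Measurable.of_discrete (f := walkWeight μ w m)).comp measurable_snd)
  induction n generalizing m with
  | zero => simp [walkChain]
  | succ n ih =>
    rw [hZ.integral_succ hr n (f := fun a => Real.exp (-a.1) * walkWeight μ w m a.2)
      (hmeas m).stronglyMeasurable]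
    · rw [show n + 1 + m = n + (m + 1) by ring, ← ih]
      refine integral_congr_ae (ae_of_all _ fun ω => ?_)
      simp only [walkStep, mem_univ, if_true]
      simp_rw [integral_const_mul, integral_mul_const]
      rw [walkWeight, ← mul_assoc]
      congr 1
      simp only [hw_def]
      split_ifs
      · simp_rw [neg_add, Real.exp_add, integral_const_mul]
        rw [integral_exp_neg_expMeasure hr]
      · simp
    · refine Integrable.of_bound ((hmeas m).comp (hZ.measurable_walkChain _)).aestronglyMeasurable 1
        (ae_of_all _ fun ω => ?_)
      rw [norm_mul, Real.norm_of_nonneg (Real.exp_pos _).le,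
        Real.norm_of_nonneg (walkWeight_mem hw _ _).1]
      refine mul_le_one₀ ?_ (walkWeight_mem hw _ _).1 (walkWeight_mem hw _ _).2
      rw [Real.exp_le_one_iff, neg_nonpos]
      exact walkChain_fst_nonneg hZ.pos _ _

/-- A mean zero walk spends an infinite amount of time in each half-line. -/
lemma ae_tendsto_occupation (hZ : IsWalkSequence P Z r μ) (hr : 0 < r)
    (hμ : Integrable (fun k : ℤ => (k : ℝ)) μ) (h0 : ∫ k : ℤ, (k : ℝ) ∂μ = 0)
    (hB : IsUpperSet B ∨ IsLowerSet B) (h0B : (0 : ℤ) ∈ B) :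
    ∀ᵐ ω ∂P, Tendsto (fun n => (walkChain B univ Z n ω).1) atTop atTop := by
  classical
  set w : ℤ → ℝ := fun s => if s ∈ B then r / (r + 1) else 1 with hw_def
  have hc : r / (r + 1) < 1 := by rw [div_lt_one (by positivity)]; linarith
  have hw (x : ℤ) : w x ∈ Icc (0 : ℝ) 1 := by
    simp only [hw_def]
    split_ifs
    · exact ⟨by positivity, hc.le⟩
    · simp
  have hmono : Monotone w ∨ Antitone w := by
    rcases hB with h | h
    · refine Or.inr fun x y hxy => ?_
      simp only [hw_def]
      by_cases hx : x ∈ B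
      · simp [hx, h hxy hx]
      · rw [if_neg hx]; exact (hw y).2
    · refine Or.inl fun x y hxy => ?_
      simp only [hw_def]
      by_cases hy : y ∈ B
      · simp [hy, h hxy hy]
      · rw [if_neg hy]; exact (hw x).2
  have ht := tendsto_walkWeight_zero hμ h0 hw hmono (x := 0) (by simpa [hw_def, h0B] using hc)
  have hint (n : ℕ) : ∫ ω, Real.exp (-(walkChain B univ Z n ω).1) ∂P = walkWeight μ w n 0 := by
    have := hZ.integral_exp_neg_walkChain hr B n 0
    simpa [walkWeight] using this
  have hm (n : ℕ) : Measurable fun ω => Real.exp (-(walkChain B univ Z n ω).1) := by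
    have := hZ.measurable_walkChain (B := B) (D := univ) n
    fun_prop
  -- Since the clock is nondecreasing, $e^{-T_n}$ converges pointwise; its expectation tends to $0$,
  -- so the limit is almost surely $0$ and $T_n\to\infty$.
  set g : Ω → ℝ := fun ω => ⨅ n, Real.exp (-(walkChain B univ Z n ω).1)
  have hg (ω : Ω) : Tendsto (fun n => Real.exp (-(walkChain B univ Z n ω).1)) atTop (𝓝 (g ω)) := by
    refine tendsto_atTop_ciInf (fun n m hnm => ?_) ⟨0, ?_⟩
    · simpa using walkChain_fst_mono hZ.pos ω hnm
    · rintro _ ⟨n, rfl⟩; exact (Real.exp_pos _).le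
  have hg0 (ω : Ω) : 0 ≤ g ω := ge_of_tendsto' (hg ω) fun n => (Real.exp_pos _).le
  have hb (n : ℕ) (ω : Ω) : ‖Real.exp (-(walkChain B univ Z n ω).1)‖ ≤ 1 := by
    rw [Real.norm_of_nonneg (Real.exp_pos _).le, Real.exp_le_one_iff, neg_nonpos]
    exact walkChain_fst_nonneg hZ.pos _ _
  have hgm : AEStronglyMeasurable g P :=
    (measurable_of_tendsto_metrizable hm (tendsto_pi_nhds.2 hg)).aestronglyMeasurable
  have hgi : Integrable g P := Integrable.of_bound hgm 1
    (ae_of_all _ fun ω => le_of_tendsto' (hg ω).norm fun n => hb n ω)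
  have hlim := tendsto_integral_of_dominated_convergence (μ := P) (fun _ => (1 : ℝ))
    (fun n => (hm n).aestronglyMeasurable) (integrable_const _)
    (fun n => ae_of_all _ (hb n)) (ae_of_all _ hg)
  simp_rw [hint] at hlim
  have hz := tendsto_nhds_unique hlim ht
  filter_upwards [(integral_eq_zero_iff_of_nonneg hg0 hgi).1 hz] with ω hω
  have h1 := hg ω
  rw [hω] at h1
  have h2 := Real.tendsto_exp_comp_nhds_zero.1 h1
  simpa [Function.comp_def] using tendsto_neg_atBot_atTop.comp h2

-- The index $m+1$ is essential: a chain stopped outside `D` must get weight $0$, whereas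
-- `walkWeight` with index $0$ equals $1$ everywhere.
open scoped Classical in
lemma integral_walkWeight_walkChain (hZ : IsWalkSequence P Z r μ) (hr : 0 < r) (B D : Set ℤ)
    (n m : ℕ) :
    ∫ ω, walkWeight μ (fun s => if s ∈ D then 1 else 0) (m + 1) (walkChain B D Z n ω).2 ∂P =
    walkWeight μ (fun s => if s ∈ D then 1 else 0) (n + m + 1) 0 := by
  have := isProbabilityMeasure_expMeasure hr
  set w : ℤ → ℝ := fun s => if s ∈ D then 1 else 0 with hw_def
  have hw (x : ℤ) : w x ∈ Icc (0 : ℝ) 1 := by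
    simp only [hw_def]
    split_ifs <;> simp
  have hmeas (m : ℕ) : Measurable fun a : ℝ × ℤ => walkWeight μ w m a.2 :=
    (Measurable.of_discrete (f := walkWeight μ w m)).comp measurable_snd
  induction n generalizing m with
  | zero => simp [walkChain]
  | succ n ih =>
    rw [hZ.integral_succ hr n (f := fun a => walkWeight μ w (m + 1) a.2)
      (hmeas _).stronglyMeasurable]
    · rw [show n + 1 + m + 1 = n + (m + 1) + 1 by ring, ← ih]
      refine integral_congr_ae (ae_of_all _ fun ω => ?_)
      by_cases hD : (walkChain B D Z n ω).2 ∈ D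
      · simp [walkStep, hD, walkWeight, hw_def]
      · simp [walkStep, hD, walkWeight, hw_def]
    · refine Integrable.of_bound
        ((hmeas (m + 1)).comp (hZ.measurable_walkChain (n + 1))).aestronglyMeasurable 1
        (ae_of_all _ fun ω => ?_)
      rw [Real.norm_of_nonneg (walkWeight_mem hw _ _).1]
      exact (walkWeight_mem hw _ _).2

open scoped Classical in
lemma ae_exists_exit (hZ : IsWalkSequence P Z r μ) (hr : 0 < r)
    (ht : Tendsto (fun n => walkWeight μ (fun s => if s ∈ D then 1 else 0) n 0) atTop (𝓝 0)) :
    ∀ᵐ ω ∂P, ∃ n, (walkChain B D Z n ω).2 ∉ D := by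
  have h1 (n : ℕ) : P.real {ω | (walkChain B D Z n ω).2 ∈ D} =
      walkWeight μ (fun s => if s ∈ D then 1 else 0) (n + 1) 0 := by
    have := hZ.integral_walkWeight_walkChain hr B D n 0
    rw [add_zero] at this
    rw [← this, ← integral_indicator_one]
    · congr 1; ext ω
      simp [walkWeight, indicator_apply]
    · exact (MeasurableSet.of_discrete (s := D)).preimage
        (measurable_snd.comp (hZ.measurable_walkChain n))
  have h2 : P.real {ω | ∀ n, (walkChain B D Z n ω).2 ∈ D} ≤ 0 := by
    refine ge_of_tendsto' ((tendsto_add_atTop_iff_nat 1).2 ht) fun n => ?_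
    rw [← h1 n]
    exact measureReal_mono fun ω hω => hω n
  have h3 : P {ω | ∀ n, (walkChain B D Z n ω).2 ∈ D} = 0 := by
    have := le_antisymm h2 measureReal_nonneg
    rwa [measureReal_eq_zero_iff] at this
  rw [ae_iff]
  simpa using h3

end IsWalkSequence
end

/-! ### Exit from the nonnegative half-line: the law of the clock. -/

section
variable {Ω : Type*} {Z : ℕ → Ω → ℝ × ℤ} {B D : Set ℤ}
variable [MeasurableSpace Ω] {P : Measure Ω} [IsProbabilityMeasure P] {r : ℝ} {μ : Measure ℤ}
  [IsProbabilityMeasure μ]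

lemma integral_ite_const (q : ℤ → Prop) [DecidablePred q] (a b : ℂ) :
    ∫ k, (if q k then a else b) ∂μ = b + (a - b) * (μ.real {k | q k} : ℂ) := by
  have h1 (k : ℤ) : (if q k then a else b) = b + {k | q k}.indicator (fun _ => a - b) k := by
    by_cases h : q k <;> simp [h]
  simp_rw [h1]
  rw [integral_add (integrable_const _)
    ((integrable_const _).indicator (MeasurableSet.of_discrete)),
    integral_indicator_const _ MeasurableSet.of_discrete]
  simp [mul_comm]

lemma norm_exp_mul_I (θ t : ℝ) : ‖Complex.exp (θ * t * Complex.I)‖ = 1 := by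
  exact_mod_cast Complex.norm_exp_ofReal_mul_I (θ * t)

lemma integral_exp_mul_I_expMeasure (hr : 0 < r) (θ : ℝ) :
    ∫ x, Complex.exp (θ * x * Complex.I) ∂(expMeasure r) = r / (r - θ * Complex.I) := by
  rw [← charFun_expMeasure hr, charFun_apply_real]

/-- The law of a geometric sum of exponential times, in terms of characteristic functions. -/
lemma geometric_exp_charFun (hr : 0 < r) {p : ℝ} (hp : 0 < p) (θ : ℝ) :
    ∃ w : ℂ, w = r / (r - θ * Complex.I) ∧ 1 - (1 - p) * w ≠ 0 ∧
      p * w / (1 - (1 - p) * w) = ((p * r : ℝ) : ℂ) / (((p * r : ℝ) : ℂ) - θ * Complex.I) := by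
  have h1 : (r : ℂ) - θ * Complex.I ≠ 0 := fun h => by
    have := congrArg Complex.re h
    simp at this; linarith
  have h2 : ((p * r : ℝ) : ℂ) - θ * Complex.I ≠ 0 := fun h => by
    have := congrArg Complex.re h
    simp at this
    rcases this with h | h <;> linarith
  have h3 : 1 - (1 - p) * ((r : ℂ) / (r - θ * Complex.I)) =
      (((p * r : ℝ) : ℂ) - θ * Complex.I) / (r - θ * Complex.I) := by
    field_simp
    push_cast
    ring
  refine ⟨_, rfl, ?_, ?_⟩
  · rw [h3]; exact div_ne_zero h2 h1
  · rw [h3]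
    push_cast at h2 ⊢
    field_simp

namespace IsWalkSequence

/-- The time spent at `0` before leaving `[0, ∞)` is exponentially distributed. -/
lemma hasLaw_walkExit_Ici (hZ : IsWalkSequence P Z r μ) (hr : 0 < r)
    (hdown : ∀ᵐ k ∂μ, -1 ≤ k) (hp : 0 < μ.real {-1})
    (hexit : ∀ᵐ ω ∂P, ∃ n, (walkChain (Iic 0) (Ici 0) Z n ω).2 ∉ Ici (0 : ℤ)) :
    HasLaw (fun ω => (walkExit (Iic 0) (Ici 0) Z ω).1) (expMeasure (μ.real {-1} * r)) P := by
  have := isProbabilityMeasure_expMeasure hr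
  set p := μ.real {-1}
  have hpr : 0 < p * r := mul_pos hp hr
  have := isProbabilityMeasure_expMeasure hpr
  have hm := (hZ.aemeasurable_walkExit hexit).fst
  have := Measure.isProbabilityMeasure_map hm
  refine ⟨hm, Measure.ext_of_charFun (funext fun θ => ?_)⟩
  rw [charFun_expMeasure hpr, charFun_apply_real, integral_map hm (by fun_prop)]
  obtain ⟨w, hw, hw0, hpw⟩ := geometric_exp_charFun hr hp θ
  rw [← hpw]
  set v : ℂ := p * w / (1 - (1 - p) * w)
  have hv' : v * (1 - (1 - p) * w) = p * w := div_mul_cancel₀ _ hw0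
  clear_value v
  -- `u s` is the expected value of $e^{i\theta T}$ for the time $T$ still to be collected from `s`:
  -- `v` before exit, $1$ afterwards. The clock runs only at $0$, where $v=w(p+(1-p)v)$; this makes
  -- `f` along the chain a martingale.
  obtain ⟨u, hu⟩ : ∃ u : ℤ → ℂ, u = fun s => if 0 ≤ s then v else 1 := ⟨_, rfl⟩
  set f : ℝ × ℤ → ℂ := fun a => Complex.exp (θ * a.1 * Complex.I) * u a.2 with hf
  have hfm : Measurable f := (by fun_prop : Measurable fun a : ℝ × ℤ =>
      Complex.exp (θ * a.1 * Complex.I)).mul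
    ((Measurable.of_discrete (f := u)).comp measurable_snd)
  have hfC (a : ℝ × ℤ) : ‖f a‖ ≤ max ‖v‖ 1 := by
    rw [hf, norm_mul, norm_exp_mul_I, one_mul, hu]
    dsimp only
    split_ifs <;> simp
  have hneg : μ.real {k : ℤ | k < 0} = p := by
    refine measureReal_congr ?_
    filter_upwards [hdown] with k hk
    refine propext ?_
    change k < 0 ↔ k = -1
    omega
  have hconst (n : ℕ) : ∫ ω, f (walkChain (Iic 0) (Ici 0) Z n ω) ∂P = v := by
    induction n with
    | zero => simp [walkChain, hf, hu]
    | succ n ih =>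
      rw [hZ.integral_succ hr n hfm.stronglyMeasurable (Integrable.of_bound
        (hfm.comp (hZ.measurable_walkChain _)).aestronglyMeasurable _ (ae_of_all _ fun ω => hfC _)),
        ← ih]
      congr 1
      ext1 ω
      set a := walkChain (Iic 0) (Ici 0) Z n ω
      have hint : ∫ k, u (a.2 + k) ∂μ = 1 + (v - 1) * (μ.real {k | 0 ≤ a.2 + k} : ℂ) := by
        rw [hu]; exact integral_ite_const _ _ _
      rcases lt_trichotomy a.2 0 with ha | ha | ha
      · simp [walkStep, not_le.2 ha]
      · have hc : {k : ℤ | 0 ≤ a.2 + k} = {k : ℤ | k < 0}ᶜ := by ext; simp [ha]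
        rw [hc, probReal_compl_eq_one_sub MeasurableSet.of_discrete, hneg] at hint
        have hs : a.2 ∈ Ici 0 := ha.ge
        have hs' : a.2 ∈ Iic 0 := ha.le
        have hs0 : u a.2 = v := by simp [hu, ha]
        simp only [walkStep, if_pos hs, if_pos hs', hs0, hf]
        simp_rw [integral_const_mul]
        rw [hint, integral_mul_const]
        push_cast
        simp_rw [mul_add, add_mul, Complex.exp_add, integral_const_mul]
        rw [integral_exp_mul_I_expMeasure hr, ← hw]
        linear_combination (-Complex.exp (θ * a.1 * Complex.I)) * hv'
      -- From a strictly positive state a step of at least $-1$ cannot leave the half-line, and the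
      -- clock stands still.
      · have h1 : μ.real {k | 0 ≤ a.2 + k} = 1 := by
          rw [← probReal_univ (μ := μ)]
          refine measureReal_congr ?_
          filter_upwards [hdown] with k hk
          refine propext (iff_true_intro ?_)
          change 0 ≤ a.2 + k
          omega
        simp only [walkStep, mem_Ici, mem_Iic, ha.le, not_le.2 ha, if_true, if_false, add_zero, hf]
        simp_rw [integral_const_mul]
        rw [hint, h1]
        simp [hu, ha.le]
  have hlim := hZ.tendsto_integral_walkExit hexit hfm hfC
  simp_rw [hconst] at hlim
  rw [← tendsto_nhds_unique hlim tendsto_const_nhds]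
  refine integral_congr_ae ?_
  filter_upwards [hexit] with ω hω
  have := walkExit_snd_notMem hω
  rw [mem_Ici] at this
  simp [hf, hu, not_le.1 this]

end IsWalkSequence

/-! ### Exit from the nonpositive half-line: Green function, exit place and clock. -/

/-- The exit probabilities of the walk from `(-∞, 0]`, weighted by the characteristic function of
the clock. -/
noncomputable def exitTransform (P : Measure Ω) (Z : ℕ → Ω → ℝ × ℤ) (θ : ℝ) (n : ℕ) (x : ℤ) : ℂ :=
  ∫ ω, Complex.exp (θ * (walkChain (Ici 0) (Iic 0) Z n ω).1 * Complex.I) *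
    (if (walkChain (Ici 0) (Iic 0) Z n ω).2 = x then 1 else 0) ∂P

lemma norm_exitIntegrand_le (θ : ℝ) (x : ℤ) (a : ℝ × ℤ) :
    ‖Complex.exp (θ * a.1 * Complex.I) * (if a.2 = x then 1 else 0)‖ ≤ 1 := by
  rw [norm_mul, norm_exp_mul_I, one_mul]
  split_ifs <;> simp

lemma measurable_exitIntegrand (θ : ℝ) (x : ℤ) : Measurable fun a : ℝ × ℤ =>
    Complex.exp (θ * a.1 * Complex.I) * (if a.2 = x then 1 else 0) :=
  (by fun_prop : Measurable fun a : ℝ × ℤ => Complex.exp (θ * a.1 * Complex.I)).mul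
    ((Measurable.of_discrete (f := fun s : ℤ => if s = x then (1 : ℂ) else 0)).comp measurable_snd)

lemma norm_exitTransform_le (θ : ℝ) (n : ℕ) (x : ℤ) : ‖exitTransform P Z θ n x‖ ≤ 1 := by
  have := norm_integral_le_of_norm_le_const (μ := P) (ae_of_all _ fun ω =>
    norm_exitIntegrand_le θ x (walkChain (Ici 0) (Iic 0) Z n ω))
  simpa [exitTransform] using this

lemma exitTransform_zero (θ : ℝ) (x : ℤ) :
    exitTransform P Z θ 0 x = if x = 0 then 1 else 0 := by
  simp [exitTransform, walkChain, eq_comm]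

/-- The forward equation. Mass at $x>0$ has been stopped and remains; new mass comes from $x-k\le0$,
with a factor $w$ only when $x-k=0$, where the clock runs. -/
lemma IsWalkSequence.exitTransform_succ (hZ : IsWalkSequence P Z r μ) (hr : 0 < r) (θ : ℝ) (n : ℕ)
    (x : ℤ) :
    exitTransform P Z θ (n + 1) x = (if 0 < x then exitTransform P Z θ n x else 0) +
      ∫ k, (if x - k ≤ 0 then (if x - k = 0 then (r / (r - θ * Complex.I) : ℂ) else 1) *
        exitTransform P Z θ n (x - k) else 0) ∂μ := by
  have := isProbabilityMeasure_expMeasure hr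
  set w : ℂ := r / (r - θ * Complex.I) with hw
  set A : Ω → ℝ × ℤ := walkChain (Ici 0) (Iic 0) Z n with hA
  have hAm : Measurable A := hZ.measurable_walkChain n
  set e : Ω → ℂ := fun ω => Complex.exp (θ * (A ω).1 * Complex.I) with he
  have hem : Measurable e := by fun_prop
  set c : ℤ → ℂ := fun s => if s ≤ 0 then (if s = 0 then w else 1) else 0 with hc
  -- The factor `c` is evaluated at `x - k` instead of the current position, so that after Fubini it
  -- leaves the integral over `ω`.
  have hstep : exitTransform P Z θ (n + 1) x =
      ∫ ω, ((if 0 < x then e ω * (if (A ω).2 = x then 1 else 0) else 0) +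
        ∫ k, e ω * c (x - k) * (if (A ω).2 = x - k then 1 else 0) ∂μ) ∂P := by
    rw [exitTransform, hZ.integral_succ hr n (measurable_exitIntegrand θ x).stronglyMeasurable]
    · congr 1
      ext1 ω
      change ∫ y, (∫ k, Complex.exp (θ * (walkStep (Ici 0) (Iic 0) (A ω) (y, k)).1 * Complex.I) *
        (if (walkStep (Ici 0) (Iic 0) (A ω) (y, k)).2 = x then 1 else 0) ∂μ) ∂(expMeasure r) = _
      have hshift (k : ℤ) : e ω * c (x - k) * (if (A ω).2 = x - k then 1 else 0) =
          e ω * c (A ω).2 * (if (A ω).2 + k = x then 1 else 0) := by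
        by_cases h : (A ω).2 = x - k
        · rw [h]; simp
        · have : ¬ (A ω).2 + k = x := fun h' => h (by omega)
          simp [h, this]
      simp_rw [hshift]
      rw [integral_const_mul]
      rcases lt_trichotomy (A ω).2 0 with ha | ha | ha
      · have hx : (if 0 < x then e ω * (if (A ω).2 = x then 1 else 0) else 0) = 0 := by
          split_ifs with h1 h2
          · omega
          · simp
          · rfl
        simp only [walkStep, mem_Iic, mem_Ici, ha.le, not_le.2 ha, if_true, if_false, add_zero]
        rw [hx]
        simp_rw [integral_const_mul]
        simp [hc, ha.le, ha.ne, he]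
      · have hx : (if 0 < x then e ω * (if (A ω).2 = x then 1 else 0) else 0) = 0 := by
          split_ifs with h1 h2
          · omega
          · simp
          · rfl
        rw [hx]
        simp only [walkStep, mem_Iic, mem_Ici, ha, le_refl, if_true, hc, zero_add]
        simp_rw [integral_const_mul, integral_mul_const]
        push_cast
        simp_rw [mul_add, add_mul, Complex.exp_add, integral_const_mul]
        rw [integral_exp_mul_I_expMeasure hr]
      · simp only [walkStep, mem_Iic, not_le.2 ha, if_false, hc, mul_zero, zero_mul, add_zero]
        by_cases h : (A ω).2 = x
        · have : 0 < x := h ▸ ha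
          simp [h, this, he]
        · simp [h]
    · exact Integrable.of_bound ((measurable_exitIntegrand θ x).comp
        (hZ.measurable_walkChain (n + 1))).aestronglyMeasurable 1
        (ae_of_all _ fun ω => norm_exitIntegrand_le _ _ _)
  have hmeas : Measurable fun q : Ω × ℤ =>
      e q.1 * c (x - q.2) * (if (A q.1).2 = x - q.2 then 1 else 0) := by
    refine Measurable.mul ?_ ?_
    · exact (hem.comp measurable_fst).mul
        ((Measurable.of_discrete (f := fun k => c (x - k))).comp measurable_snd)
    · refine Measurable.ite ?_ measurable_const measurable_const
      exact measurableSet_eq_fun ((measurable_snd.comp hAm).comp measurable_fst)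
        ((Measurable.of_discrete (f := fun k : ℤ => x - k)).comp measurable_snd)
  have hcb (s : ℤ) : ‖c s‖ ≤ max ‖w‖ 1 := by
    simp only [hc]; split_ifs <;> simp
  have hib : Integrable (fun q : Ω × ℤ =>
      e q.1 * c (x - q.2) * (if (A q.1).2 = x - q.2 then 1 else 0)) (P.prod μ) := by
    refine Integrable.of_bound hmeas.aestronglyMeasurable (max ‖w‖ 1) (ae_of_all _ fun q => ?_)
    rw [norm_mul, norm_mul, norm_exp_mul_I, one_mul]
    have h1 : ‖if (A q.1).2 = x - q.2 then (1 : ℂ) else 0‖ ≤ 1 := by split_ifs <;> simp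
    have h2 := mul_le_mul (hcb (x - q.2)) h1 (norm_nonneg _) (zero_le_one.trans (le_max_right _ _))
    rwa [mul_one] at h2
  rw [hstep, integral_add, integral_integral_swap hib]
  · congr 1
    · split_ifs
      · rfl
      · simp
    · congr 1
      ext1 k
      have h1 (ω : Ω) : e ω * c (x - k) * (if (A ω).2 = x - k then 1 else 0) =
        c (x - k) * (e ω * (if (A ω).2 = x - k then 1 else 0)) := by ring
      simp_rw [h1]
      rw [integral_const_mul]
      simp only [hc]
      rw [ite_mul, zero_mul]
      rfl
  · split_ifs
    · exact Integrable.of_bound ((measurable_exitIntegrand θ x).comp hAm).aestronglyMeasurable 1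
        (ae_of_all _ fun ω => norm_exitIntegrand_le _ _ _)
    · exact integrable_const _
  · exact hib.integral_prod_left
end

section
variable {Ω : Type*} {Z : ℕ → Ω → ℝ × ℤ}
variable [MeasurableSpace Ω] {P : Measure Ω} [IsProbabilityMeasure P] {r : ℝ} {μ : Measure ℤ}
  [IsProbabilityMeasure μ]

/-- The expected number of visits to `x` before leaving `(-∞, 0]`, among the first `n` positions,
weighted by the characteristic function of the clock after the visit. -/
noncomputable def exitGreen (P : Measure Ω) (Z : ℕ → Ω → ℝ × ℤ) (r θ : ℝ) (n : ℕ) (x : ℤ) : ℂ :=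
  (if x = 0 then (r / (r - θ * Complex.I) : ℂ) else 1) *
    ∑ i ∈ Finset.range n, exitTransform P Z θ i x

lemma norm_exp_transform_le (hr : 0 < r) (θ : ℝ) : ‖(r / (r - θ * Complex.I) : ℂ)‖ ≤ 1 := by
  have := isProbabilityMeasure_expMeasure hr
  rw [← charFun_expMeasure hr]
  exact norm_charFun_le_one _

lemma norm_ite_exp_transform_le (hr : 0 < r) (θ : ℝ) (x : ℤ) :
    ‖(if x = 0 then (r / (r - θ * Complex.I) : ℂ) else 1)‖ ≤ 1 := by
  split_ifs
  · exact norm_exp_transform_le hr θ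
  · simp

lemma norm_exitGreen_le (hr : 0 < r) (θ : ℝ) (n : ℕ) (x : ℤ) :
    ‖exitGreen P Z r θ n x‖ ≤ n := by
  rw [exitGreen, norm_mul]
  refine (mul_le_of_le_one_left (norm_nonneg _) (norm_ite_exp_transform_le hr θ x)).trans ?_
  refine (norm_sum_le_of_le _ fun i _ => norm_exitTransform_le θ i x).trans ?_
  simp

lemma integrable_ite_exitGreen (hr : 0 < r) (θ : ℝ) (n : ℕ) (x : ℤ) :
    Integrable (fun k => if x - k ≤ 0 then exitGreen P Z r θ n (x - k) else 0) μ := by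
  refine integrable_int_of_bound _ n fun k => ?_
  split_ifs
  · exact norm_exitGreen_le hr θ n _
  · simp

lemma integral_exitGreen_succ (hr : 0 < r) (θ : ℝ) (n : ℕ) (x : ℤ) :
    ∫ k, (if x - k ≤ 0 then exitGreen P Z r θ (n + 1) (x - k) else 0) ∂μ =
      ∫ k, (if x - k ≤ 0 then exitGreen P Z r θ n (x - k) else 0) ∂μ +
      ∫ k, (if x - k ≤ 0 then (if x - k = 0 then (r / (r - θ * Complex.I) : ℂ) else 1) *
        exitTransform P Z θ n (x - k) else 0) ∂μ := by
  rw [← integral_add (integrable_ite_exitGreen hr θ n x)]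
  · congr 1
    ext1 k
    by_cases h : x - k ≤ 0
    · simp only [h, if_true, exitGreen, Finset.sum_range_succ, mul_add]
    · simp only [h, if_false, add_zero]
  · refine integrable_int_of_bound _ 1 fun k => ?_
    split_ifs with h1 h2
    · rw [norm_mul]
      exact mul_le_one₀ (norm_exp_transform_le hr θ) (norm_nonneg _) (norm_exitTransform_le θ n _)
    · simpa using norm_exitTransform_le θ n _
    · simp

namespace IsWalkSequence

/-- Exit at `x` happens by one jump from some $x-k\le0$; summing over the time of that jump produces
the Green function. -/
lemma exitTransform_eq_of_pos (hZ : IsWalkSequence P Z r μ) (hr : 0 < r) (θ : ℝ) (n : ℕ) {x : ℤ}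
    (hx : 0 < x) : exitTransform P Z θ n x =
      ∫ k, (if x - k ≤ 0 then exitGreen P Z r θ n (x - k) else 0) ∂μ := by
  induction n with
  | zero => simp [exitTransform_zero, hx.ne', exitGreen]
  | succ n ih => rw [integral_exitGreen_succ hr, hZ.exitTransform_succ hr, if_pos hx, ih]

/-- Balance of visits: a visit to $x\le0$ is either the start or an arrival by one step from within
the half-line. -/
lemma exitGreen_succ_eq (hZ : IsWalkSequence P Z r μ) (hr : 0 < r) (θ : ℝ) (n : ℕ) {x : ℤ}
    (hx : x ≤ 0) : exitGreen P Z r θ (n + 1) x =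
      (if x = 0 then (r / (r - θ * Complex.I) : ℂ) else 1) * ((if x = 0 then 1 else 0) +
      ∫ k, (if x - k ≤ 0 then exitGreen P Z r θ n (x - k) else 0) ∂μ) := by
  rw [exitGreen]
  congr 1
  induction n with
  | zero => simp [exitTransform_zero, exitGreen]
  | succ n ih =>
    rw [Finset.sum_range_succ, ih, integral_exitGreen_succ hr, hZ.exitTransform_succ hr,
      if_neg (not_lt.2 hx), zero_add, add_assoc]

/-- The Green function of the walk in `(-∞, 0]` is constant in the limit; the error is controlled
by the probability that the reversed walk has not left the half-line. -/
lemma norm_sub_exitGreen_le (hZ : IsWalkSequence P Z r μ) (hr : 0 < r)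
    (hdown : ∀ᵐ k ∂μ, -1 ≤ k) (θ : ℝ) {c w : ℂ} (hw : w = r / (r - θ * Complex.I))
    (hc : c * (1 - (1 - μ.real {-1}) * w) = w) (n : ℕ) {x : ℤ} (hx : x ≤ 0) :
    ‖c - exitGreen P Z r θ n x‖ ≤ ‖c‖ * walkWeight μ (fun s => if 0 ≤ s then 1 else 0) n (-x) := by
  have hb (x : ℤ) : (if 0 ≤ x then 1 else 0 : ℝ) ∈ Icc (0 : ℝ) 1 := by split_ifs <;> simp
  induction n generalizing x with
  | zero => simp [exitGreen, walkWeight]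
  | succ n ih =>
    have hi := integrable_ite_exitGreen (P := P) (Z := Z) (μ := μ) hr θ n x
    have hic : Integrable (fun k => if x - k ≤ 0 then c else 0) μ := by
      refine integrable_int_of_bound _ ‖c‖ fun k => ?_
      split_ifs <;> simp
    have hW := norm_ite_exp_transform_le hr θ x
    -- The constant `c` solves the balance equation. For $x<0$ every step $k\ge-1$ has $x-k\le0$;
    -- for $x=0$ only $k=-1$ is excluded, which leaves $c=w(1+(1-p)c)$.
    have hbal : c = (if x = 0 then (r / (r - θ * Complex.I) : ℂ) else 1) *
        ((if x = 0 then 1 else 0) + ∫ k, (if x - k ≤ 0 then c else 0) ∂μ) := by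
      rw [integral_ite_const, sub_zero, zero_add, ← hw]
      rcases hx.lt_or_eq with h | rfl
      · have h1 : μ.real {k | x - k ≤ 0} = 1 := by
          rw [← probReal_univ (μ := μ)]
          refine measureReal_congr ?_
          filter_upwards [hdown] with k hk
          refine propext (iff_true_intro ?_)
          change x - k ≤ 0
          omega
        rw [h1]; simp [h.ne]
      · have h1 : μ.real {k : ℤ | 0 - k ≤ 0} = 1 - μ.real {-1} := by
          rw [← probReal_compl_eq_one_sub MeasurableSet.of_discrete]
          refine measureReal_congr ?_
          filter_upwards [hdown] with k hk
          refine propext ?_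
          change 0 - k ≤ 0 ↔ ¬ k = -1
          omega
        rw [h1]
        simp only [if_true]
        push_cast
        linear_combination hc
    rw [hZ.exitGreen_succ_eq hr θ n hx]
    nth_rewrite 1 [hbal]
    rw [← mul_sub, add_sub_add_left_eq_sub, ← integral_sub hic hi, norm_mul]
    refine (mul_le_of_le_one_left (norm_nonneg _) hW).trans ?_
    -- In the variable $-x$, the predecessor $x-k$ becomes $-x+k$, so the error is propagated by the
    -- law `μ` itself on $[0,\infty)$.
    rw [walkWeight, if_pos (by omega), one_mul, ← integral_const_mul]
    refine norm_integral_le_of_norm_le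
      ((integrable_walkWeight hb n _).const_mul _) (ae_of_all _ fun k => ?_)
    split_ifs with h
    · have := ih h
      rwa [show -(x - k) = -x + k by ring] at this
    · simpa using mul_nonneg (norm_nonneg _) (walkWeight_mem hb n _).1

/-- The Green function tends to `c` pointwise and is bounded by $2\|c\|$, so it may be replaced by
`c` under the integral over the last step; that step must satisfy $k\ge x$. -/
lemma tendsto_exitTransform (hZ : IsWalkSequence P Z r μ) (hr : 0 < r)
    (hdown : ∀ᵐ k ∂μ, -1 ≤ k) (θ : ℝ) {c w : ℂ} (hw : w = r / (r - θ * Complex.I))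
    (hc : c * (1 - (1 - μ.real {-1}) * w) = w)
    (hb : ∀ y : ℤ, 0 ≤ y → Tendsto (fun n => walkWeight μ (fun s => if 0 ≤ s then 1 else 0) n y)
      atTop (𝓝 0)) {x : ℤ} (hx : 0 < x) :
    Tendsto (fun n => exitTransform P Z θ n x) atTop (𝓝 (c * (μ.real (Ici x) : ℂ))) := by
  have hmem (x : ℤ) : (if 0 ≤ x then 1 else 0 : ℝ) ∈ Icc (0 : ℝ) 1 := by split_ifs <;> simp
  have hlim : c * (μ.real (Ici x) : ℂ) = ∫ k, (if x - k ≤ 0 then c else 0) ∂μ := by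
    rw [integral_ite_const, sub_zero, zero_add]
    congr 3
    ext k; simp
  rw [hlim]
  simp_rw [fun n => hZ.exitTransform_eq_of_pos hr θ n hx]
  refine tendsto_integral_of_dominated_convergence (fun _ => ‖c‖ + ‖c‖)
    (fun n => (integrable_ite_exitGreen hr θ n x).aestronglyMeasurable) (integrable_const _)
    (fun n => ae_of_all _ fun k => ?_) (ae_of_all _ fun k => ?_)
  · split_ifs with h
    · have h1 := hZ.norm_sub_exitGreen_le hr hdown θ hw hc n h
      have h2 := mul_le_of_le_one_right (norm_nonneg c) (walkWeight_mem (μ := μ) hmem n (-(x - k))).2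
      have h3 := norm_sub_norm_le (exitGreen P Z r θ n (x - k)) c
      rw [norm_sub_rev] at h3
      linarith
    · rw [norm_zero]; positivity
  · split_ifs with h
    · rw [← tendsto_sub_nhds_zero_iff]
      refine squeeze_zero_norm (a := fun n => ‖c‖ *
        walkWeight μ (fun s => if 0 ≤ s then 1 else 0) n (-(x - k))) (fun n => ?_) ?_
      · rw [norm_sub_rev]
        exact hZ.norm_sub_exitGreen_le hr hdown θ hw hc n h
      · simpa using (hb (-(x - k)) (by omega)).const_mul ‖c‖
    · exact tendsto_const_nhds

lemma integral_exit_Iic (hZ : IsWalkSequence P Z r μ) (hr : 0 < r)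
    (hdown : ∀ᵐ k ∂μ, -1 ≤ k) (θ : ℝ) {c w : ℂ} (hw : w = r / (r - θ * Complex.I))
    (hc : c * (1 - (1 - μ.real {-1}) * w) = w)
    (hb : ∀ y : ℤ, 0 ≤ y → Tendsto (fun n => walkWeight μ (fun s => if 0 ≤ s then 1 else 0) n y)
      atTop (𝓝 0))
    (hexit : ∀ᵐ ω ∂P, ∃ n, (walkChain (Ici 0) (Iic 0) Z n ω).2 ∉ Iic (0 : ℤ))
    {x : ℤ} (hx : 0 < x) :
    ∫ ω, Complex.exp (θ * (walkExit (Ici 0) (Iic 0) Z ω).1 * Complex.I) *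
      (if (walkExit (Ici 0) (Iic 0) Z ω).2 = x then 1 else 0) ∂P = c * (μ.real (Ici x) : ℂ) :=
  tendsto_nhds_unique (hZ.tendsto_integral_walkExit hexit (measurable_exitIntegrand θ x)
    (norm_exitIntegrand_le θ x)) (hZ.tendsto_exitTransform hr hdown θ hw hc hb hx)

/-- The law of the first positive value of the walk. -/
lemma measureReal_exit_Iic (hZ : IsWalkSequence P Z r μ) (hr : 0 < r)
    (hdown : ∀ᵐ k ∂μ, -1 ≤ k) (hp : 0 < μ.real {-1})
    (hb : ∀ y : ℤ, 0 ≤ y → Tendsto (fun n => walkWeight μ (fun s => if 0 ≤ s then 1 else 0) n y)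
      atTop (𝓝 0))
    (hexit : ∀ᵐ ω ∂P, ∃ n, (walkChain (Ici 0) (Iic 0) Z n ω).2 ∉ Iic (0 : ℤ))
    {x : ℤ} (hx : 0 < x) :
    P.real {ω | (walkExit (Ici 0) (Iic 0) Z ω).2 = x} = μ.real (Ici x) / μ.real {-1} := by
  have hr' : (r : ℂ) ≠ 0 := by exact_mod_cast hr.ne'
  have hp' : (μ.real {-1} : ℂ) ≠ 0 := by exact_mod_cast hp.ne'
  -- At $\theta=0$ the clock factor is $1$ and the constant is $1/p$, the expected number of visits
  -- to each point.
  have h := hZ.integral_exit_Iic hr hdown 0 (c := (μ.real {-1} : ℂ)⁻¹) (w := 1)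
    (by simp [hr']) (by field_simp; ring) hb hexit hx
  have hnull : NullMeasurableSet {ω | (walkExit (Ici 0) (Iic 0) Z ω).2 = x} P :=
    (hZ.aemeasurable_walkExit hexit).snd.nullMeasurableSet_preimage (MeasurableSet.singleton x)
  have h1 : ∫ ω, Complex.exp ((0 : ℝ) * (walkExit (Ici 0) (Iic 0) Z ω).1 * Complex.I) *
      (if (walkExit (Ici 0) (Iic 0) Z ω).2 = x then 1 else 0) ∂P =
      (P.real {ω | (walkExit (Ici 0) (Iic 0) Z ω).2 = x} : ℂ) := by
    have h2 : (fun ω => Complex.exp ((0 : ℝ) * (walkExit (Ici 0) (Iic 0) Z ω).1 * Complex.I) *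
      (if (walkExit (Ici 0) (Iic 0) Z ω).2 = x then 1 else 0)) =
      {ω | (walkExit (Ici 0) (Iic 0) Z ω).2 = x}.indicator fun _ => (1 : ℂ) := by
      ext ω; simp [indicator_apply]
    rw [h2, integral_indicator₀ hnull]
    simp
  rw [h1] at h
  have h3 : ((μ.real {-1} : ℂ))⁻¹ * (μ.real (Ici x) : ℂ) =
      ((μ.real (Ici x) / μ.real {-1} : ℝ) : ℂ) := by
    push_cast; field_simp
  rw [h3] at h
  exact_mod_cast h

/-- The time spent at `0` before leaving `(-∞, 0]` is exponentially distributed. -/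
lemma hasLaw_walkExit_Iic (hZ : IsWalkSequence P Z r μ) (hr : 0 < r)
    (hdown : ∀ᵐ k ∂μ, -1 ≤ k) (hp : 0 < μ.real {-1})
    (hb : ∀ y : ℤ, 0 ≤ y → Tendsto (fun n => walkWeight μ (fun s => if 0 ≤ s then 1 else 0) n y)
      atTop (𝓝 0))
    (hexit : ∀ᵐ ω ∂P, ∃ n, (walkChain (Ici 0) (Iic 0) Z n ω).2 ∉ Iic (0 : ℤ)) :
    HasLaw (fun ω => (walkExit (Ici 0) (Iic 0) Z ω).1) (expMeasure (μ.real {-1} * r)) P := by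
  set p := μ.real {-1}
  have hpr : 0 < p * r := mul_pos hp hr
  have hp' : (p : ℂ) ≠ 0 := by exact_mod_cast hp.ne'
  have := isProbabilityMeasure_expMeasure hpr
  have hm2 := hZ.aemeasurable_walkExit hexit
  have hm := hm2.fst
  have := Measure.isProbabilityMeasure_map hm
  refine ⟨hm, Measure.ext_of_charFun (funext fun θ => ?_)⟩
  rw [charFun_expMeasure hpr, charFun_apply_real, integral_map hm (by fun_prop)]
  obtain ⟨w, hw, hw0, hpw⟩ := geometric_exp_charFun hr hp θ
  rw [← hpw]
  set X := walkExit (Ici 0) (Iic 0) Z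
  set A : ℤ → Set Ω := fun x => {ω | (X ω).2 = x} with hA
  have hAm (x : ℤ) : NullMeasurableSet (A x) P :=
    hm2.snd.nullMeasurableSet_preimage (MeasurableSet.singleton x)
  have hdisj : Pairwise (Function.onFun Disjoint A) := fun x y hxy =>
    disjoint_left.2 fun ω h1 h2 => hxy (h1.symm.trans h2)
  have hU : ⋃ x, A x = univ := by ext ω; simp [hA]
  have hint : Integrable (fun ω => Complex.exp (θ * (X ω).1 * Complex.I)) P :=
    Integrable.of_bound (by fun_prop : AEMeasurable _ P).aestronglyMeasurable 1
      (ae_of_all _ fun ω => (norm_exp_mul_I _ _).le)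
  have hsum := hasSum_integral_iUnion_ae hAm (fun x y h => (hdisj h).aedisjoint)
    hint.integrableOn
  have hone := hasSum_integral_iUnion_ae (f := fun _ => (1 : ℂ)) hAm
    (fun x y h => (hdisj h).aedisjoint) (integrable_const (μ := P) (1 : ℂ)).integrableOn
  rw [hU] at hsum hone
  simp only [Measure.restrict_univ] at hsum hone
  -- On each exit event the transform is one and the same factor times the probability of the event.
  -- Summing over `x` therefore needs no separate evaluation of $\sum_x\mu[x,\infty)$.
  have hterm (x : ℤ) : ∫ ω in A x, Complex.exp (θ * (X ω).1 * Complex.I) ∂P =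
      (p * w / (1 - (1 - p) * w)) * ∫ _ in A x, (1 : ℂ) ∂P := by
    have hreal : ∫ _ in A x, (1 : ℂ) ∂P = (P.real (A x) : ℂ) := by simp
    rcases lt_or_ge 0 x with hx | hx
    · have h1 : ∫ ω in A x, Complex.exp (θ * (X ω).1 * Complex.I) ∂P =
          ∫ ω, Complex.exp (θ * (X ω).1 * Complex.I) * (if (X ω).2 = x then 1 else 0) ∂P := by
        rw [← integral_indicator₀ (hAm x)]
        congr 1
        ext ω; simp [indicator_apply, hA]
      rw [h1, hreal, hZ.integral_exit_Iic hr hdown θ hw (c := w / (1 - (1 - p) * w))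
        (div_mul_cancel₀ _ hw0) hb hexit hx,
        hZ.measureReal_exit_Iic hr hdown hp hb hexit hx]
      change _ = _ * ((μ.real (Ici x) / p : ℝ) : ℂ)
      push_cast
      field_simp
    · have h0 : P (A x) = 0 := by
        refine measure_mono_null (t := {ω | ¬ ∃ n, (walkChain (Ici 0) (Iic 0) Z n ω).2 ∉ Iic (0 : ℤ)})
          (fun ω hω hn => ?_) hexit
        have := walkExit_snd_notMem hn
        rw [mem_Iic] at this
        exact this (le_of_eq_of_le hω hx)
      rw [Measure.restrict_eq_zero.2 h0]
      simp
  simp_rw [hterm] at hsum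
  have := hsum.unique (hone.mul_left _)
  rw [this]
  simp

end IsWalkSequence
end

/-! ### Deterministic jump paths and their fast-forwarding. -/

lemma exists_mem_Ico_of_tendsto {a : ℕ → ℝ} (ha : Tendsto a atTop atTop) {t : ℝ} (ht : a 0 ≤ t) :
    ∃ n, t ∈ Ico (a n) (a (n + 1)) := by
  classical
  have hex : ∃ n, t < a n := (ha.eventually_gt_atTop t).exists
  obtain ⟨n, hn⟩ : ∃ n, Nat.find hex = n + 1 := by
    refine Nat.exists_eq_succ_of_ne_zero fun h => ?_
    have := Nat.find_spec hex
    rw [h] at this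
    linarith
  refine ⟨n, ?_, ?_⟩
  · exact not_lt.1 (Nat.find_min hex (by omega))
  · rw [← hn]; exact Nat.find_spec hex

section
variable {e s : ℕ → ℝ} {f : ℝ → ℝ} {B : Set ℝ}

/-- The time of the `n`-th arrival. -/
noncomputable def arrivalTime (e : ℕ → ℝ) (n : ℕ) : ℝ := ∑ i ∈ Finset.range n, e i

open scoped Classical in
/-- The time spent in `B` up to the `n`-th arrival, by a path with successive states `s`. -/
noncomputable def clockTime (e s : ℕ → ℝ) (B : Set ℝ) (n : ℕ) : ℝ :=
  ∑ i ∈ Finset.range n, if s i ∈ B then e i else 0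

lemma arrivalTime_succ (e : ℕ → ℝ) (n : ℕ) : arrivalTime e (n + 1) = arrivalTime e n + e n :=
  Finset.sum_range_succ _ _

open scoped Classical in
lemma clockTime_succ (e s : ℕ → ℝ) (B : Set ℝ) (n : ℕ) :
    clockTime e s B (n + 1) = clockTime e s B n + if s n ∈ B then e n else 0 :=
  Finset.sum_range_succ _ _

lemma arrivalTime_zero : arrivalTime e 0 = 0 := Finset.sum_range_zero _

lemma clockTime_zero : clockTime e s B 0 = 0 := Finset.sum_range_zero _

lemma arrivalTime_strictMono (he : ∀ i, 0 < e i) : StrictMono (arrivalTime e) :=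
  strictMono_nat_of_lt_succ fun n => by rw [arrivalTime_succ]; linarith [he n]

lemma clockTime_mono (he : ∀ i, 0 < e i) : Monotone (clockTime e s B) :=
  monotone_nat_of_le_succ fun n => by
    rw [clockTime_succ]
    split_ifs
    · linarith [he n]
    · simp

lemma arrivalTime_nonneg (he : ∀ i, 0 < e i) (n : ℕ) : 0 ≤ arrivalTime e n :=
  Finset.sum_nonneg fun i _ => (he i).le

lemma clockTime_le_arrivalTime (he : ∀ i, 0 < e i) (n : ℕ) :
    clockTime e s B n ≤ arrivalTime e n :=
  Finset.sum_le_sum fun i _ => by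
    split_ifs
    · exact le_rfl
    · exact (he i).le

lemma tendsto_arrivalTime (he : ∀ i, 0 < e i) (hK : Tendsto (clockTime e s B) atTop atTop) :
    Tendsto (arrivalTime e) atTop atTop :=
  tendsto_atTop_mono (clockTime_le_arrivalTime he) hK

lemma arrivalCount_eq (he : ∀ i, 0 < e i) {n : ℕ} {t : ℝ}
    (ht : t ∈ Ico (arrivalTime e n) (arrivalTime e (n + 1))) : arrivalCount e t = n := by
  have h : {m : ℕ | ∑ i ∈ Finset.range (m + 1), e i ≤ t} = Iio n := by
    ext m
    change arrivalTime e (m + 1) ≤ t ↔ m < n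
    constructor
    · intro hm
      have := (arrivalTime_strictMono he).lt_iff_lt.1 (hm.trans_lt ht.2)
      omega
    · intro hm
      exact ((arrivalTime_strictMono he).monotone (by omega : m + 1 ≤ n)).trans ht.1
  rw [arrivalCount, h, Set.ncard_eq_toFinset_card']
  simp

lemma path_eq_of_mem_Ico (he : ∀ i, 0 < e i) (hf : ∀ t, 0 ≤ t → f t = s (arrivalCount e t))
    {n : ℕ} {t : ℝ} (ht : t ∈ Ico (arrivalTime e n) (arrivalTime e (n + 1))) : f t = s n := by
  rw [hf t ((arrivalTime_nonneg he n).trans ht.1), arrivalCount_eq he ht]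

lemma isCadlagPath_of_arrivals (he : ∀ i, 0 < e i)
    (hf : ∀ t, 0 ≤ t → f t = s (arrivalCount e t)) (hT : Tendsto (arrivalTime e) atTop atTop) :
    IsCadlagPath f := by
  constructor
  · intro t ht
    obtain ⟨n, hn⟩ := exists_mem_Ico_of_tendsto hT (t := t) (arrivalTime_zero.trans_le ht)
    have h1 : f =ᶠ[𝓝[≥] t] fun _ => s n := by
      filter_upwards [Ico_mem_nhdsGE hn.2] with u hu
      exact path_eq_of_mem_Ico he hf ⟨hn.1.trans hu.1, hu.2⟩
    exact (continuousWithinAt_const (b := s n)).congr_of_eventuallyEq h1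
      (path_eq_of_mem_Ico he hf hn)
  · intro t ht
    obtain ⟨m, hm⟩ := exists_mem_Ico_of_tendsto hT (t := t) (arrivalTime_zero.trans_le ht.le)
    -- For the left limit the holding interval must be open at its left end, so an arrival time
    -- belongs to the interval before it.
    obtain ⟨n, h1, h2⟩ : ∃ n, arrivalTime e n < t ∧ t ≤ arrivalTime e (n + 1) := by
      rcases hm.1.lt_or_eq with h | h
      · exact ⟨m, h, hm.2.le⟩
      · obtain ⟨n, rfl⟩ : ∃ n, m = n + 1 := by
          refine Nat.exists_eq_succ_of_ne_zero fun h0 => ?_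
          rw [h0, arrivalTime_zero] at h
          linarith
        exact ⟨n, h ▸ arrivalTime_strictMono he (Nat.lt_succ_self n), h.ge⟩
    refine ⟨s n, tendsto_nhds_of_eventually_eq ?_⟩
    filter_upwards [Ioo_mem_nhdsLT h1] with u hu
    exact path_eq_of_mem_Ico he hf ⟨hu.1.le, hu.2.trans_le h2⟩

/-- A lower bound is enough for infinite volume. The holding intervals in `B` are added one at a
time, so measurability of the occupied set is not needed. -/
lemma ofReal_clockTime_le (he : ∀ i, 0 < e i) (hf : ∀ t, 0 ≤ t → f t = s (arrivalCount e t))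
    (n : ℕ) : ENNReal.ofReal (clockTime e s B n) ≤
      volume ({t : ℝ | 0 ≤ t ∧ f t ∈ B} ∩ Iio (arrivalTime e n)) := by
  induction n with
  | zero => simp [clockTime_zero]
  | succ n ih =>
    set A : Set ℝ := {t : ℝ | 0 ≤ t ∧ f t ∈ B}
    rw [clockTime_succ]
    split_ifs with h
    · refine ENNReal.ofReal_add_le.trans ?_
      have h1 : Disjoint (A ∩ Iio (arrivalTime e n))
          (Ico (arrivalTime e n) (arrivalTime e (n + 1))) :=
        disjoint_left.2 fun t ht1 ht2 => (not_lt.2 ht2.1) ht1.2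
      have h2 : ENNReal.ofReal (e n) =
          volume (Ico (arrivalTime e n) (arrivalTime e (n + 1))) := by
        rw [Real.volume_Ico, arrivalTime_succ, add_sub_cancel_left]
      rw [h2]
      refine (add_le_add_left ih _).trans ?_
      rw [← measure_union h1 measurableSet_Ico]
      refine measure_mono (union_subset ?_ ?_)
      · exact inter_subset_inter_right _
          (Iio_subset_Iio ((arrivalTime_strictMono he).monotone (Nat.le_succ n)))
      · intro t ht
        refine ⟨⟨(arrivalTime_nonneg he n).trans ht.1, ?_⟩, ht.2⟩
        rwa [path_eq_of_mem_Ico he hf ht]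
    · rw [add_zero]
      exact ih.trans (measure_mono (inter_subset_inter_right _
        (Iio_subset_Iio ((arrivalTime_strictMono he).monotone (Nat.le_succ n)))))

lemma volume_eq_top_of_clockTime (he : ∀ i, 0 < e i)
    (hf : ∀ t, 0 ≤ t → f t = s (arrivalCount e t)) (hK : Tendsto (clockTime e s B) atTop atTop) :
    volume {t : ℝ | 0 ≤ t ∧ f t ∈ B} = ⊤ := by
  rw [eq_top_iff]
  refine le_of_tendsto' (ENNReal.tendsto_ofReal_nhds_top.2 hK) fun n => ?_
  exact (ofReal_clockTime_le he hf n).trans (measure_mono inter_subset_left)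

open scoped Classical in
lemma occupation_piece (he : ∀ i, 0 < e i) (hf : ∀ t, 0 ≤ t → f t = s (arrivalCount e t))
    (n : ℕ) {t : ℝ} (ht : t ∈ Icc (arrivalTime e n) (arrivalTime e (n + 1))) :
    IntervalIntegrable (fun z => B.indicator (fun _ => (1 : ℝ)) (f z)) volume (arrivalTime e n) t ∧
      ∫ z in (arrivalTime e n)..t, B.indicator (fun _ => (1 : ℝ)) (f z) =
        if s n ∈ B then t - arrivalTime e n else 0 := by
  have hae : ∀ᵐ z : ℝ, z ∈ uIoc (arrivalTime e n) t →
      B.indicator (fun _ => (1 : ℝ)) (f z) = if s n ∈ B then 1 else 0 := by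
    filter_upwards [compl_mem_ae_iff.2 (measure_singleton t)] with z hz hzI
    rw [uIoc_of_le ht.1] at hzI
    rw [path_eq_of_mem_Ico he hf ⟨hzI.1.le, (hzI.2.lt_of_ne hz).trans_le ht.2⟩, indicator_apply]
  constructor
  · refine (intervalIntegrable_const (c := if s n ∈ B then (1 : ℝ) else 0)).congr_ae ?_
    rw [EventuallyEq, ae_restrict_iff' measurableSet_uIoc]
    filter_upwards [hae] with z hz hzI using (hz hzI).symm
  · rw [intervalIntegral.integral_congr_ae hae, intervalIntegral.integral_const]
    simp

open scoped Classical in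
lemma occupationTime_eq (he : ∀ i, 0 < e i) (hf : ∀ t, 0 ≤ t → f t = s (arrivalCount e t))
    (n : ℕ) {t : ℝ} (ht : t ∈ Icc (arrivalTime e n) (arrivalTime e (n + 1))) :
    occupationTime f B t = clockTime e s B n + if s n ∈ B then t - arrivalTime e n else 0 := by
  have key (n : ℕ) : IntervalIntegrable (fun z => B.indicator (fun _ => (1 : ℝ)) (f z)) volume 0
      (arrivalTime e n) ∧ ∫ z in (0 : ℝ)..(arrivalTime e n), B.indicator (fun _ => (1 : ℝ)) (f z) =
        clockTime e s B n := by
    induction n with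
    | zero => simp [arrivalTime_zero, clockTime_zero]
    | succ n ih =>
      have h := occupation_piece (B := B) he hf n (t := arrivalTime e (n + 1))
        ⟨(arrivalTime_strictMono he).monotone (Nat.le_succ n), le_rfl⟩
      refine ⟨ih.1.trans h.1, ?_⟩
      rw [← intervalIntegral.integral_add_adjacent_intervals ih.1 h.1, ih.2, h.2, clockTime_succ,
        arrivalTime_succ, add_sub_cancel_left]
  have h := occupation_piece (B := B) he hf n ht
  rw [occupationTime, ← intervalIntegral.integral_add_adjacent_intervals (key n).1 h.1, (key n).2,
    h.2]

lemma mem_of_clockTime_lt {n : ℕ} (h : clockTime e s B n < clockTime e s B (n + 1)) : s n ∈ B := by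
  by_contra hn
  rw [clockTime_succ, if_neg hn] at h
  simp at h

lemma occupationInverse_eq (he : ∀ i, 0 < e i) (hf : ∀ t, 0 ≤ t → f t = s (arrivalCount e t))
    (hT : Tendsto (arrivalTime e) atTop atTop) {n : ℕ} {t : ℝ}
    (ht : t ∈ Ico (clockTime e s B n) (clockTime e s B (n + 1))) :
    occupationInverse f B t = arrivalTime e n + (t - clockTime e s B n) := by
  have hn := mem_of_clockTime_lt (ht.1.trans_lt ht.2)
  have ht2 := ht.2
  rw [clockTime_succ, if_pos hn] at ht2
  set σ := arrivalTime e n + (t - clockTime e s B n) with hσ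
  have hσ0 : 0 ≤ σ := add_nonneg (arrivalTime_nonneg he n) (sub_nonneg.2 ht.1)
  have hσT : σ < arrivalTime e (n + 1) := by rw [arrivalTime_succ]; linarith
  -- The occupation time equals `t` at `σ` and increases strictly just after it, because `s n ∈ B`.
  -- The condition `0 < u` is automatic from $\sigma\ge0$.
  have hset : {u : ℝ | 0 < u ∧ t < occupationTime f B u} = Ioi σ := by
    ext u
    rw [mem_ofPred_eq, mem_Ioi]
    constructor
    · rintro ⟨hu0, hu⟩
      by_contra! hle
      obtain ⟨m, hm⟩ := exists_mem_Ico_of_tendsto hT (t := u)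
        (by rw [arrivalTime_zero]; exact hu0.le)
      have hmn : m < n + 1 := (arrivalTime_strictMono he).lt_iff_lt.1
        (hm.1.trans_lt (hle.trans_lt hσT))
      have hA := occupationTime_eq (B := B) he hf m ⟨hm.1, hm.2.le⟩
      rcases (Nat.lt_succ_iff.1 hmn).lt_or_eq with h | rfl
      · have h1 : occupationTime f B u ≤ clockTime e s B (m + 1) := by
          rw [hA, clockTime_succ]
          have := hm.2
          rw [arrivalTime_succ] at this
          split_ifs <;> linarith
        have h2 : clockTime e s B (m + 1) ≤ clockTime e s B n := clockTime_mono he h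
        linarith [ht.1]
      · rw [hA, if_pos hn] at hu
        linarith
    · intro hu
      have hu0 := hσ0.trans_lt hu
      refine ⟨hu0, ?_⟩
      obtain ⟨m, hm⟩ := exists_mem_Ico_of_tendsto hT (t := u)
        (by rw [arrivalTime_zero]; exact hu0.le)
      have hnm : n < m + 1 := (arrivalTime_strictMono he).lt_iff_lt.1
        ((le_add_of_nonneg_right (sub_nonneg.2 ht.1)).trans_lt (hu.trans hm.2))
      have hA := occupationTime_eq (B := B) he hf m ⟨hm.1, hm.2.le⟩
      rcases (Nat.lt_succ_iff.1 hnm).lt_or_eq with h | rfl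
      · have h1 : clockTime e s B m ≤ occupationTime f B u := by
          rw [hA]
          split_ifs
          · linarith [hm.1]
          · simp
        exact (ht.2.trans_le (clockTime_mono he h)).trans_le h1
      · rw [hA, if_pos hn]
        linarith
  rw [occupationInverse, hset, csInf_Ioi]

lemma fastForward_eq (he : ∀ i, 0 < e i) (hf : ∀ t, 0 ≤ t → f t = s (arrivalCount e t))
    (hT : Tendsto (arrivalTime e) atTop atTop) {n : ℕ} {t : ℝ}
    (ht : t ∈ Ico (clockTime e s B n) (clockTime e s B (n + 1))) :
    f (occupationInverse f B t) = s n := by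
  rw [occupationInverse_eq he hf hT ht]
  refine path_eq_of_mem_Ico he hf ⟨le_add_of_nonneg_right (sub_nonneg.2 ht.1), ?_⟩
  have ht2 := ht.2
  rw [clockTime_succ, if_pos (mem_of_clockTime_lt (ht.1.trans_lt ht.2))] at ht2
  rw [arrivalTime_succ]
  linarith

lemma clockTime_lt_of_mem (he : ∀ i, 0 < e i) {n : ℕ} (h : s n ∈ B) :
    clockTime e s B n < clockTime e s B (n + 1) := by
  rw [clockTime_succ, if_pos h]
  linarith [he n]

/-- The first jump of a fast-forwarded pure jump path. -/
lemma firstJump_fastForward (he : ∀ i, 0 < e i) (hf : ∀ t, 0 ≤ t → f t = s (arrivalCount e t))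
    (hK : Tendsto (clockTime e s B) atTop atTop) {ν : ℕ} (h0 : s 0 ∈ B) (hν : s ν ∈ B)
    (hne : s ν ≠ s 0) (hlt : ∀ n < ν, s n ∈ B → s n = s 0) :
    firstJumpTime (fun t => f (occupationInverse f B t)) = clockTime e s B ν ∧
      firstJumpState (fun t => f (occupationInverse f B t)) = s ν := by
  have hT := tendsto_arrivalTime he hK
  have hFν : f (occupationInverse f B (clockTime e s B ν)) = s ν :=
    fastForward_eq he hf hT ⟨le_rfl, clockTime_lt_of_mem he hν⟩
  have hF0 : f (occupationInverse f B 0) = s 0 := by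
    refine fastForward_eq he hf hT ⟨clockTime_zero.le, ?_⟩
    rw [← clockTime_zero (e := e) (s := s) (B := B)]
    exact clockTime_lt_of_mem he h0
  have htime : firstJumpTime (fun t => f (occupationInverse f B t)) = clockTime e s B ν := by
    -- The infimum is attained: at earlier times the fast-forwarded path shows only states `s n ∈ B`
    -- with `n < ν`, all equal to `s 0`.
    refine IsLeast.csInf_eq ⟨⟨?_, ?_⟩, ?_⟩
    · rw [← clockTime_zero (e := e) (s := s) (B := B)]
      exact clockTime_mono he (Nat.zero_le ν)
    · dsimp only
      rw [hFν, hF0]; exact hne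
    · rintro t ⟨ht0, ht⟩
      by_contra! hlt'
      obtain ⟨n, hn⟩ := exists_mem_Ico_of_tendsto hK (t := t) (by rwa [clockTime_zero])
      have hnν : n < ν := (clockTime_mono he).reflect_lt (hn.1.trans_lt hlt')
      dsimp only at ht
      rw [fastForward_eq he hf hT hn, hF0] at ht
      exact ht (hlt n hnν (mem_of_clockTime_lt (hn.1.trans_lt hn.2)))
  exact ⟨htime, by rw [firstJumpState, htime]; exact hFν⟩

end

/-! ### The step law of the embedded walk. -/

section
variable {φ : Measure ℝ} {h : ℝ}

/-- The probability that the embedded walk moves by `j - 1` grid steps. -/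
noncomputable def gridStepWeight (φ : Measure ℝ) (h : ℝ) (j : ℕ) : ℝ :=
  if j = 1 then 0 else grunwaldCoeff φ h j / (-grunwaldCoeff φ h 1)

/-- The jump distribution of the embedded walk, in units of `h`. -/
noncomputable def gridStepLaw (φ : Measure ℝ) (h : ℝ) : Measure ℤ :=
  Measure.sum fun j : ℕ => ENNReal.ofReal (gridStepWeight φ h j) • Measure.dirac ((j : ℤ) - 1)

/-- The floor is a measurable map defined on all of $\mathbb R$ that inverts $k\mapsto hk$ on the
grid, where the jump law lives. -/
lemma map_grunwaldJumpLaw (hh : 0 < h) :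
    (grunwaldJumpLaw φ h).map (fun x => ⌊x / h⌋) = gridStepLaw φ h := by
  classical
  have hm : Measurable fun x : ℝ => ⌊x / h⌋ := (measurable_id.div_const h).floor
  ext S hS
  rw [grunwaldJumpLaw, gridStepLaw, Measure.map_apply hm hS, Measure.sum_apply _ (hm hS),
    Measure.sum_apply _ hS]
  have h1 (j : ℕ) : (ENNReal.ofReal (gridStepWeight φ h j) • Measure.dirac ((j : ℤ) - 1)) S =
      ({j : ℕ | j ≠ 1}).indicator (fun j => (ENNReal.ofReal (grunwaldCoeff φ h j /
        (-grunwaldCoeff φ h 1)) • Measure.dirac (((j : ℕ) - 1 : ℝ) * h))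
          ((fun x => ⌊x / h⌋) ⁻¹' S)) j := by
    by_cases hj : j = 1
    · simp [hj, gridStepWeight]
    · have hfl : ⌊((j : ℝ) - 1) * h / h⌋ = (j : ℤ) - 1 := by
        rw [mul_div_cancel_right₀ _ hh.ne']
        exact_mod_cast Int.floor_intCast ((j : ℤ) - 1)
      rw [indicator_of_mem (show j ∈ {j : ℕ | j ≠ 1} from hj)]
      simp only [Measure.smul_apply, Measure.dirac_apply' _ hS, Measure.dirac_apply' _ (hm hS),
        gridStepWeight, hj, if_false]
      have hind : S.indicator (1 : ℤ → ENNReal) ((j : ℤ) - 1) =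
          ((fun x : ℝ => ⌊x / h⌋) ⁻¹' S).indicator 1 (((j : ℝ) - 1) * h) := by
        simp only [indicator_apply, mem_preimage, hfl, Pi.one_apply]
      rw [hind]
  rw [tsum_congr h1]
  exact tsum_subtype {j : ℕ | j ≠ 1} fun j => (ENNReal.ofReal (grunwaldCoeff φ h j /
        (-grunwaldCoeff φ h 1)) • Measure.dirac (((j : ℕ) - 1 : ℝ) * h)) ((fun x => ⌊x / h⌋) ⁻¹' S)

lemma ae_grunwaldJumpLaw (hh : 0 < h) :
    ∀ᵐ x ∂(grunwaldJumpLaw φ h), x = h * (⌊x / h⌋ : ℝ) := by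
  have hm : Measurable fun x : ℝ => ⌊x / h⌋ := (measurable_id.div_const h).floor
  have hS : MeasurableSet {x : ℝ | x = h * (⌊x / h⌋ : ℝ)} :=
    measurableSet_eq_fun measurable_id
      (measurable_const.mul ((Measurable.of_discrete (f := fun k : ℤ => (k : ℝ))).comp hm))
  rw [grunwaldJumpLaw, Measure.ae_sum_iff' hS]
  intro j
  refine Measure.ae_smul_measure ?_ _
  rw [ae_dirac_iff hS]
  have hfl : ⌊((j : ℕ) - 1 : ℝ) * h / h⌋ = ((j : ℕ) : ℤ) - 1 := by
    rw [mul_div_cancel_right₀ _ hh.ne']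
    exact_mod_cast Int.floor_intCast (((j : ℕ) : ℤ) - 1)
  rw [hfl]
  push_cast
  ring

lemma ae_gridStepLaw : ∀ᵐ k ∂(gridStepLaw φ h), -1 ≤ k := by
  rw [gridStepLaw, Measure.ae_sum_iff' MeasurableSet.of_discrete]
  intro j
  refine Measure.ae_smul_measure ?_ _
  rw [ae_dirac_iff MeasurableSet.of_discrete]
  omega

lemma AdmissibleLevyMeasure.gridStepWeight_nonneg (hφ : AdmissibleLevyMeasure φ) (hh : 0 < h)
    (j : ℕ) : 0 ≤ gridStepWeight φ h j := by
  have h1 := hφ.grunwaldCoeff_one_neg hh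
  unfold gridStepWeight
  match j with
  | 0 => exact div_nonneg (hφ.grunwaldCoeff_zero_pos hh).le (by linarith)
  | 1 => simp
  | j + 2 => exact div_nonneg (hφ.grunwaldCoeff_add_two_pos hh j).le (by linarith)

lemma AdmissibleLevyMeasure.gridStepWeight_pos (hφ : AdmissibleLevyMeasure φ) (hh : 0 < h)
    {j : ℕ} (hj : j ≠ 1) : 0 < gridStepWeight φ h j := by
  have h1 := hφ.grunwaldCoeff_one_neg hh
  unfold gridStepWeight
  match j with
  | 0 => exact div_pos (hφ.grunwaldCoeff_zero_pos hh) (by linarith)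
  | 1 => exact absurd rfl hj
  | j + 2 => exact div_pos (hφ.grunwaldCoeff_add_two_pos hh j) (by linarith)

open scoped Classical in
lemma gridStepLaw_apply (S : Set ℤ) : gridStepLaw φ h S =
    ∑' j : ℕ, if (j : ℤ) - 1 ∈ S then ENNReal.ofReal (gridStepWeight φ h j) else 0 := by
  classical
  rw [gridStepLaw, Measure.sum_apply _ MeasurableSet.of_discrete]
  refine tsum_congr fun j => ?_
  simp [Measure.dirac_apply' _ (MeasurableSet.of_discrete (s := S)), indicator_apply]

lemma gridStepLaw_singleton (j : ℕ) :
    gridStepLaw φ h {(j : ℤ) - 1} = ENNReal.ofReal (gridStepWeight φ h j) := by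
  classical
  rw [gridStepLaw_apply, tsum_eq_single j]
  · simp
  · intro i hi
    rw [if_neg]
    rw [mem_singleton_iff]; omega

lemma AdmissibleLevyMeasure.gridStepLaw_real_neg_one (hφ : AdmissibleLevyMeasure φ) (hh : 0 < h) :
    (gridStepLaw φ h).real {-1} = grunwaldCoeff φ h 0 / (-grunwaldCoeff φ h 1) := by
  have h1 := gridStepLaw_singleton (φ := φ) (h := h) 0
  rw [show ((0 : ℕ) : ℤ) - 1 = -1 by norm_num] at h1
  rw [Measure.real, h1, ENNReal.toReal_ofReal (hφ.gridStepWeight_nonneg hh 0)]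
  rfl

lemma AdmissibleLevyMeasure.gridStepLaw_real_neg_one_pos (hφ : AdmissibleLevyMeasure φ)
    (hh : 0 < h) : 0 < (gridStepLaw φ h).real {-1} := by
  rw [hφ.gridStepLaw_real_neg_one hh]
  exact div_pos (hφ.grunwaldCoeff_zero_pos hh) (by linarith [hφ.grunwaldCoeff_one_neg hh])

lemma AdmissibleLevyMeasure.gridStepLaw_singleton_ne_zero (hφ : AdmissibleLevyMeasure φ)
    (hh : 0 < h) {j : ℕ} (hj : j ≠ 1) : gridStepLaw φ h {(j : ℤ) - 1} ≠ 0 := by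
  rw [gridStepLaw_singleton]
  exact (ENNReal.ofReal_pos.2 (hφ.gridStepWeight_pos hh hj)).ne'

lemma AdmissibleLevyMeasure.gridStepLaw_real_Ici (hφ : AdmissibleLevyMeasure φ) (hh : 0 < h)
    [IsProbabilityMeasure (gridStepLaw φ h)] {j : ℕ} (hj : 1 ≤ j) :
    (gridStepLaw φ h).real (Ici (j : ℤ)) =
      -(∑ i ∈ Finset.range (j + 1), grunwaldCoeff φ h i) / (-grunwaldCoeff φ h 1) := by
  have hG := hφ.grunwaldCoeff_one_neg hh
  have h1 : gridStepLaw φ h (Iio (j : ℤ)) =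
      ∑ i ∈ Finset.range (j + 1), ENNReal.ofReal (gridStepWeight φ h i) := by
    rw [gridStepLaw_apply, tsum_eq_sum (s := Finset.range (j + 1))]
    · refine Finset.sum_congr rfl fun i hi => if_pos ?_
      rw [Finset.mem_range] at hi
      rw [mem_Iio]; omega
    · intro i hi
      rw [Finset.mem_range] at hi
      rw [if_neg]
      rw [mem_Iio]; omega
  have h2 : (gridStepLaw φ h).real (Iio (j : ℤ)) =
      ∑ i ∈ Finset.range (j + 1), gridStepWeight φ h i := by
    rw [Measure.real, h1, ENNReal.toReal_sum fun i _ => ENNReal.ofReal_ne_top]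
    exact Finset.sum_congr rfl fun i _ => ENNReal.toReal_ofReal (hφ.gridStepWeight_nonneg hh i)
  -- Restoring the missing term $i=1$, which equals $-1$, costs a $+1$ that cancels the total mass
  -- when passing to the complement.
  have h3 (i : ℕ) : gridStepWeight φ h i =
      grunwaldCoeff φ h i / (-grunwaldCoeff φ h 1) + if i = 1 then 1 else 0 := by
    unfold gridStepWeight
    split_ifs with hi
    · rw [hi, div_neg, div_self hG.ne]; simp
    · simp
  rw [← compl_Iio, probReal_compl_eq_one_sub MeasurableSet.of_discrete, h2]
  simp_rw [h3]
  rw [Finset.sum_add_distrib, ← Finset.sum_div, Finset.sum_ite_eq' (Finset.range (j + 1)) 1,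
    if_pos (by rw [Finset.mem_range]; omega)]
  ring

/-- The mean step vanishes: the term $j=0$ contributes $-p$, and by `hasSum_mul_grunwaldCoeff` the
terms $j\ge2$ contribute $p$. -/
lemma AdmissibleLevyMeasure.hasSum_gridStepWeight (hφ : AdmissibleLevyMeasure φ) (hh : 0 < h) :
    HasSum (fun j : ℕ => gridStepWeight φ h j * ((j : ℝ) - 1)) 0 := by
  have h1 := (hφ.hasSum_mul_grunwaldCoeff hh).div_const (-grunwaldCoeff φ h 1)
  rw [← hasSum_nat_add_iff' 2]
  convert! h1 using 1
  · ext j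
    simp only [gridStepWeight, show j + 2 ≠ 1 by omega, if_false]
    push_cast
    ring
  · simp [Finset.sum_range_succ, gridStepWeight]

lemma AdmissibleLevyMeasure.integrable_gridStepLaw (hφ : AdmissibleLevyMeasure φ) (hh : 0 < h) :
    Integrable (fun k : ℤ => (k : ℝ)) (gridStepLaw φ h) := by
  refine integrable_sum_dirac (fun i => ENNReal.ofReal_ne_top) ?_
  refine (hφ.hasSum_gridStepWeight hh).summable.norm.congr fun j => ?_
  rw [norm_mul, Real.norm_of_nonneg (hφ.gridStepWeight_nonneg hh j),
    ENNReal.toReal_ofReal (hφ.gridStepWeight_nonneg hh j)]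
  push_cast
  rfl

lemma AdmissibleLevyMeasure.integral_gridStepLaw (hφ : AdmissibleLevyMeasure φ) (hh : 0 < h) :
    ∫ k : ℤ, (k : ℝ) ∂(gridStepLaw φ h) = 0 := by
  refine (hasSum_integral_measure (hφ.integrable_gridStepLaw hh)).unique ?_
  convert! hφ.hasSum_gridStepWeight hh using 2 with j
  rw [integral_smul_measure, integral_dirac,
    ENNReal.toReal_ofReal (hφ.gridStepWeight_nonneg hh j)]
  push_cast
  rfl

end

/-! ### From compound Poisson data to a walk sequence. -/

section
variable {Ω : Type*} [MeasurableSpace Ω] {P : Measure Ω} [IsProbabilityMeasure P]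

lemma expMeasure_ae_pos {r : ℝ} (hr : 0 < r) : ∀ᵐ x ∂(expMeasure r), 0 < x := by
  have := isProbabilityMeasure_expMeasure hr
  have h1 := cdf_expMeasure_eq hr 0
  rw [cdf_eq_real, if_pos le_rfl] at h1
  simp only [mul_zero, neg_zero, Real.exp_zero, sub_self] at h1
  rw [measureReal_eq_zero_iff] at h1
  rw [ae_iff]
  convert! h1 using 2
  ext x; simp

/-- The holding times and the grid steps of a compound Poisson process on a grid, modified on a
null set, form a walk sequence. -/
lemma exists_isWalkSequence {r h : ℝ} (hr : 0 < r) {ν : Measure ℝ} {E ξ : ℕ → Ω → ℝ}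
    (hE : ∀ m, HasLaw (E m) (expMeasure r) P) (hξ : ∀ m, HasLaw (ξ m) ν P)
    (hind : iIndepFun (Sum.elim E ξ) P) (hν : ∀ᵐ x ∂ν, x = h * (⌊x / h⌋ : ℝ)) :
    ∃ Z : ℕ → Ω → ℝ × ℤ, IsWalkSequence P Z r (ν.map fun x => ⌊x / h⌋) ∧
      ∀ᵐ ω ∂P, ∀ n, E n ω = (Z n ω).1 ∧ ξ n ω = h * ((Z n ω).2 : ℝ) := by
  classical
  have hfl : Measurable fun x : ℝ => ⌊x / h⌋ := (measurable_id.div_const h).floor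
  -- Measurable versions, reset to $1$ where they fail to be positive; exponential times are almost
  -- surely positive, so only a null set changes.
  set E' : ℕ → Ω → ℝ := fun n ω =>
    if 0 < (hE n).aemeasurable.mk (E n) ω then (hE n).aemeasurable.mk (E n) ω else 1 with hE'
  set ξ' : ℕ → Ω → ℝ := fun n => (hξ n).aemeasurable.mk (ξ n)
  have hE'm (n : ℕ) : Measurable (E' n) := by
    have := (hE n).aemeasurable.measurable_mk
    exact Measurable.ite (measurableSet_lt measurable_const this) this measurable_const
  have hξ'm (n : ℕ) : Measurable (ξ' n) := (hξ n).aemeasurable.measurable_mk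
  have hEE (n : ℕ) : E n =ᵐ[P] E' n := by
    have hpos : ∀ᵐ ω ∂P, 0 < E n ω :=
      ((hE n).ae_iff (p := fun x => 0 < x) (measurableSet_Ioi.mem)).2 (expMeasure_ae_pos hr)
    filter_upwards [(hE n).aemeasurable.ae_eq_mk, hpos] with ω h1 h2
    rw [h1] at h2
    simp only [hE', if_pos h2, ← h1]
  have hξξ (n : ℕ) : ξ n =ᵐ[P] ξ' n := (hξ n).aemeasurable.ae_eq_mk
  have hind' : iIndepFun (Sum.elim E' ξ') P := hind.congr fun i => by
    rcases i with n | n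
    · exact hEE n
    · exact hξξ n
  have hmeas (i : ℕ ⊕ ℕ) : Measurable (Sum.elim E' ξ' i) := by
    rcases i with n | n
    · exact hE'm n
    · exact hξ'm n
  refine ⟨fun n ω => (E' n ω, ⌊ξ' n ω / h⌋), ⟨fun n => (hE'm n).prodMk (hfl.comp (hξ'm n)),
    fun n ω => ?_, fun n => ?_, fun n => ?_⟩, ?_⟩
  · simp only [hE']
    split_ifs with h1
    · exact h1
    · exact one_pos
  · have h1 : IndepFun (E' n) (ξ' n) P :=
      hind'.indepFun (i := Sum.inl n) (j := Sum.inr n) (by simp)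
    have h2 : IndepFun (E' n) (fun ω => ⌊ξ' n ω / h⌋) P := h1.comp measurable_id hfl
    rw [(indepFun_iff_map_prod_eq_prod_map_map (hE'm n).aemeasurable
      (f := E' n) (g := fun ω => ⌊ξ' n ω / h⌋) (hfl.comp (hξ'm n)).aemeasurable).1 h2]
    congr 1
    · rw [← (hE n).map_eq, Measure.map_congr (hEE n)]
    · rw [← (hξ n).map_eq, Measure.map_congr (hξξ n), Measure.map_map hfl (hξ'm n)]
      rfl
  -- Holding times and jumps form one independent family indexed by a sum type; the past and the
  -- present are disjoint blocks of it, each containing indices of both kinds.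
  · set S : Finset (ℕ ⊕ ℕ) := (Finset.range n).disjSum (Finset.range n)
    set T : Finset (ℕ ⊕ ℕ) := ({n} : Finset ℕ).disjSum {n}
    have hST : Disjoint S T := by
      rw [Finset.disjoint_left]
      rintro (i | i) hi hi'
      · simp only [S, T, Finset.inl_mem_disjSum, Finset.mem_range, Finset.mem_singleton] at hi hi'
        omega
      · simp only [S, T, Finset.inr_mem_disjSum, Finset.mem_range, Finset.mem_singleton] at hi hi'
        omega
    have h1 := hind'.indepFun_finset S T hST hmeas
    refine h1.comp (φ := fun (y : S → ℝ) (i : Finset.range n) =>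
      ((y ⟨Sum.inl i, Finset.inl_mem_disjSum.2 i.2⟩,
        ⌊y ⟨Sum.inr i, Finset.inr_mem_disjSum.2 i.2⟩ / h⌋) : ℝ × ℤ))
      (ψ := fun (y : T → ℝ) => ((y ⟨Sum.inl n, Finset.inl_mem_disjSum.2 (by simp)⟩,
        ⌊y ⟨Sum.inr n, Finset.inr_mem_disjSum.2 (by simp)⟩ / h⌋) : ℝ × ℤ)) ?_ ?_
    · exact measurable_pi_lambda _ fun i =>
        (measurable_pi_apply _).prodMk (hfl.comp (measurable_pi_apply _))
    · exact (measurable_pi_apply _).prodMk (hfl.comp (measurable_pi_apply _))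
  · have hgrid : ∀ᵐ ω ∂P, ∀ n, ξ n ω = h * (⌊ξ n ω / h⌋ : ℝ) := ae_all_iff.2 fun n => by
      have h1 := (hξ n).map_eq
      rw [← h1] at hν
      exact ae_of_ae_map (hξ n).aemeasurable hν
    filter_upwards [ae_all_iff.2 hEE, ae_all_iff.2 hξξ, hgrid] with ω h1 h2 h3 n
    exact ⟨h1 n, by rw [← h2 n]; exact h3 n⟩

end

/-! ### Fast-forwarded grid paths and the exit of the embedded walk. -/

section
variable {Ω : Type*} {Z : ℕ → Ω → ℝ × ℤ} {B D : Set ℤ} {ω : Ω}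

lemma walkChain_univ_snd (n : ℕ) :
    (walkChain B univ Z n ω).2 = ∑ i ∈ Finset.range n, (Z i ω).2 := by
  induction n with
  | zero => rfl
  | succ n ih => simp [walkChain, walkStep, ih, Finset.sum_range_succ]

lemma walkChain_univ_fst {s : ℕ → ℝ} {A : Set ℝ}
    (hs : ∀ n, s n ∈ A ↔ ∑ i ∈ Finset.range n, (Z i ω).2 ∈ B) (n : ℕ) :
    (walkChain B univ Z n ω).1 = clockTime (fun i => (Z i ω).1) s A n := by
  induction n with
  | zero => rw [clockTime_zero]; rfl
  | succ n ih =>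
    have h1 := hs n
    rw [← walkChain_univ_snd (B := B)] at h1
    simp only [walkChain, walkStep, mem_univ, if_true, clockTime_succ, ih]
    by_cases h : s n ∈ A
    · simp [h, h1.1 h]
    · simp [h, mt h1.2 h]

/-- This links the unstopped walk, whose clock measures occupation, with the stopped walk, whose
exit law is known. -/
lemma walkChain_eq_univ {n : ℕ} (h : ∀ m < n, (walkChain B univ Z m ω).2 ∈ D) :
    walkChain B D Z n ω = walkChain B univ Z n ω := by
  induction n with
  | zero => rfl
  | succ n ih =>
    have h1 := ih fun m hm => h m (hm.trans (Nat.lt_succ_self n))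
    rw [walkChain, walkChain, h1]
    simp [walkStep, h n (Nat.lt_succ_self n)]

lemma exists_walkExit_eq (h : ∃ n, (walkChain B D Z n ω).2 ∉ D) :
    ∃ ν, walkExit B D Z ω = walkChain B univ Z ν ω ∧ (walkChain B univ Z ν ω).2 ∉ D ∧
      ∀ n < ν, (walkChain B univ Z n ω).2 ∈ D := by
  classical
  have hex : ∃ n, (walkChain B univ Z n ω).2 ∉ D := by
    by_contra! hall
    obtain ⟨n, hn⟩ := h
    exact hn (walkChain_eq_univ (n := n) (fun m _ => hall m) ▸ hall n)
  have hlt (n : ℕ) (hn : n < Nat.find hex) : (walkChain B univ Z n ω).2 ∈ D :=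
    not_not.1 (Nat.find_min hex hn)
  refine ⟨Nat.find hex, ?_, Nat.find_spec hex, hlt⟩
  have heq : walkChain B D Z (Nat.find hex) ω = walkChain B univ Z (Nat.find hex) ω :=
    walkChain_eq_univ hlt
  have hout : (walkChain B D Z (Nat.find hex) ω).2 ∉ D := by
    rw [heq]; exact Nat.find_spec hex
  rw [← heq, walkExit]
  exact (walkChain_eq_of_exit (walkExit_snd_notMem h) (Nat.sInf_le hout)).symm

lemma neg_one_le_walkExit_Ici (hdown : ∀ n, -1 ≤ (Z n ω).2) :
    -1 ≤ (walkExit B (Ici 0) Z ω).2 := by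
  have h (n : ℕ) : -1 ≤ (walkChain B (Ici 0) Z n ω).2 := by
    induction n with
    | zero => simp [walkChain]
    | succ n ih =>
      by_cases h1 : 0 ≤ (walkChain B (Ici 0) Z n ω).2
      · have := hdown n
        simp only [walkChain, walkStep, mem_Ici, h1, if_true]
        omega
      · simpa only [walkChain, walkStep, mem_Ici, h1, if_false] using ih
  exact h _

/-- The first jump of a fast-forwarded compound Poisson path on a grid, in terms of the exit of
the embedded walk from the deleted region and `0`. -/
lemma gridPath_fastForward {x h : ℝ} (hh : 0 < h) {f : ℝ → ℝ} {A : Set ℝ}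
    (hpos : ∀ i, 0 < (Z i ω).1)
    (hf : ∀ t, 0 ≤ t → f t = x + h *
      ((∑ i ∈ Finset.range (arrivalCount (fun i => (Z i ω).1) t), (Z i ω).2 : ℤ) : ℝ))
    (hA : ∀ k : ℤ, x + h * (k : ℝ) ∈ A ↔ k ∈ B) (h0B : (0 : ℤ) ∈ B) (hBD : ∀ k ∈ B, k ∈ D → k = 0)
    (h0D : (0 : ℤ) ∈ D) (hDB : ∀ k, k ∉ D → k ∈ B)
    (hK : Tendsto (fun n => (walkChain B univ Z n ω).1) atTop atTop)
    (hexit : ∃ n, (walkChain B D Z n ω).2 ∉ D) :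
    IsCadlagPath f ∧ volume {t : ℝ | 0 ≤ t ∧ f t ∈ A} = ⊤ ∧
      firstJumpTime (fun t => f (occupationInverse f A t)) = (walkExit B D Z ω).1 ∧
      firstJumpState (fun t => f (occupationInverse f A t)) =
        x + h * ((walkExit B D Z ω).2 : ℝ) := by
  set s : ℕ → ℝ := fun n => x + h * ((∑ i ∈ Finset.range n, (Z i ω).2 : ℤ) : ℝ) with hs
  have hmem (n : ℕ) : s n ∈ A ↔ ∑ i ∈ Finset.range n, (Z i ω).2 ∈ B := hA _
  have hclock := walkChain_univ_fst (B := B) hmem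
  have hK' : Tendsto (clockTime (fun i => (Z i ω).1) s A) atTop atTop := by
    simpa only [hclock] using hK
  have hpath : ∀ t, 0 ≤ t → f t = s (arrivalCount (fun i => (Z i ω).1) t) := hf
  refine ⟨isCadlagPath_of_arrivals hpos hpath (tendsto_arrivalTime hpos hK'),
    volume_eq_top_of_clockTime hpos hpath hK', ?_⟩
  obtain ⟨ν, hν, hout, hlt⟩ := exists_walkExit_eq hexit
  rw [walkChain_univ_snd] at hout
  have h0 : s 0 ∈ A := (hmem 0).2 (by simpa using h0B)
  have hne : s ν ≠ s 0 := fun heq => by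
    simp only [hs, Finset.sum_range_zero, Int.cast_zero, mul_zero, add_zero, add_eq_left,
      mul_eq_zero, hh.ne', false_or, Int.cast_eq_zero] at heq
    rw [heq] at hout
    exact hout h0D
  have key := firstJump_fastForward hpos hpath hK' h0 ((hmem ν).2 (hDB _ hout)) hne
    fun n hn hnA => by
      have h1 := hlt n hn
      rw [walkChain_univ_snd] at h1
      simp only [hs, hBD _ ((hmem n).1 hnA) h1]
      simp
  rw [hν, hclock, walkChain_univ_snd]
  exact key

end

/-! ### Application to the Grünwald process. -/

section
variable {Ω : Type*} [MeasurableSpace Ω] {P : Measure Ω} [IsProbabilityMeasure P] {φ : Measure ℝ}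
  {h : ℝ}

lemma IsGrunwaldProcess.exists_isWalkSequence {Y : ℝ → Ω → ℝ} {x : ℝ}
    (hY : IsGrunwaldProcess P Y φ h x) (hφ : AdmissibleLevyMeasure φ) (hh : 0 < h) :
    IsProbabilityMeasure (gridStepLaw φ h) ∧ ∃ Z : ℕ → Ω → ℝ × ℤ,
      IsWalkSequence P Z (-grunwaldCoeff φ h 1) (gridStepLaw φ h) ∧
      (∀ᵐ ω ∂P, ∀ n, -1 ≤ (Z n ω).2) ∧
      ∀ᵐ ω ∂P, ∀ t, 0 ≤ t → Y t ω = x + h *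
        ((∑ i ∈ Finset.range (arrivalCount (fun i => (Z i ω).1) t), (Z i ω).2 : ℤ) : ℝ) := by
  obtain ⟨E, ξ, hE, hξ, hind, hYeq⟩ := hY
  have hr : 0 < -grunwaldCoeff φ h 1 := by linarith [hφ.grunwaldCoeff_one_neg hh]
  have hfl : Measurable fun x : ℝ => ⌊x / h⌋ := (measurable_id.div_const h).floor
  -- Total mass one is read off from the existence of a variable with this law, so $\sum_j\mathcal
  -- G_j=0$ needs no separate proof.
  have hprob : IsProbabilityMeasure (gridStepLaw φ h) := by
    have h1 : IsProbabilityMeasure (grunwaldJumpLaw φ h) := (hξ 0).isProbabilityMeasure_iff.1 ‹_›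
    rw [← map_grunwaldJumpLaw hh]
    exact Measure.isProbabilityMeasure_map hfl.aemeasurable
  obtain ⟨Z, hZ, hEZ⟩ := _root_.exists_isWalkSequence hr hE hξ hind (ae_grunwaldJumpLaw hh)
  rw [map_grunwaldJumpLaw hh] at hZ
  refine ⟨hprob, Z, hZ, ae_all_iff.2 fun n => ?_, ?_⟩
  · have := isProbabilityMeasure_expMeasure hr
    have h1 : P.map (fun ω => (Z n ω).2) = gridStepLaw φ h := by
      have h2 := Measure.map_map (μ := P) measurable_snd (hZ.measurable n)
      rw [hZ.map_eq n, Measure.map_snd_prod] at h2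
      simpa [Function.comp_def] using h2.symm
    have h3 := ae_gridStepLaw (φ := φ) (h := h)
    rw [← h1] at h3
    exact ae_of_ae_map (measurable_snd.comp (hZ.measurable n)).aemeasurable h3
  · filter_upwards [hYeq, hEZ] with ω h1 h2 t ht
    have h3 : (fun i => E i ω) = fun i => (Z i ω).1 := funext fun i => (h2 i).1
    rw [h1 t ht, h3]
    push_cast
    rw [Finset.mul_sum]
    exact congrArg _ (Finset.sum_congr rfl fun i _ => (h2 i).2)

/-- The point $-1$ has weight $0$, and a step $y+1\ge1$, which has positive probability, leads from
it to `y`. -/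
lemma AdmissibleLevyMeasure.tendsto_walkWeight_Ici (hφ : AdmissibleLevyMeasure φ) (hh : 0 < h)
    [IsProbabilityMeasure (gridStepLaw φ h)] {y : ℤ} (hy : 0 ≤ y) :
    Tendsto (fun n => walkWeight (gridStepLaw φ h) (fun s => if 0 ≤ s then 1 else 0) n y)
      atTop (𝓝 0) := by
  have hk : gridStepLaw φ h {y + 1} ≠ 0 := by
    have := hφ.gridStepLaw_singleton_ne_zero hh (j := (y + 2).toNat) (by omega)
    rwa [show (((y + 2).toNat : ℕ) : ℤ) - 1 = y + 1 by omega] at this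
  have := tendsto_walkWeight_zero_of_step (hφ.integrable_gridStepLaw hh)
    (hφ.integral_gridStepLaw hh) (w := fun s : ℤ => if 0 ≤ s then 1 else 0)
    (fun s => by split_ifs <;> simp)
    (Or.inl fun a b hab => by dsimp only; split_ifs <;> first | omega | simp)
    (x := -1) (by simp) hk
  rwa [show -1 + (y + 1) = y by ring] at this

lemma AdmissibleLevyMeasure.tendsto_walkWeight_Iic (hφ : AdmissibleLevyMeasure φ) (hh : 0 < h)
    [IsProbabilityMeasure (gridStepLaw φ h)] :
    Tendsto (fun n => walkWeight (gridStepLaw φ h) (fun s => if s ≤ 0 then 1 else 0) n 0)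
      atTop (𝓝 0) := by
  have hk : gridStepLaw φ h {-1} ≠ 0 := by
    simpa using hφ.gridStepLaw_singleton_ne_zero hh (j := 0) (by omega)
  have := tendsto_walkWeight_zero_of_step (hφ.integrable_gridStepLaw hh)
    (hφ.integral_gridStepLaw hh) (w := fun s : ℤ => if s ≤ 0 then 1 else 0)
    (fun s => by split_ifs <;> simp)
    (Or.inr fun a b hab => by dsimp only; split_ifs <;> first | omega | simp)
    (x := 1) (by simp) hk
  simpa using this

/-- Position `k` of the walk is the state $-1+(1+k)h$, so the hidden states are exactly $k\le-1$,
including $-1$ itself. Until the walk leaves $(-\infty,0]$ only $0$ is visible, and landing on index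
`j` means exit at `j`. -/
lemma leftFastForward_grunwaldProcess {Y : ℝ → Ω → ℝ} (hφ : AdmissibleLevyMeasure φ)
    (hh : 0 < h) (hY : IsGrunwaldProcess P Y φ h (-1 + h)) :
    (∀ᵐ ω ∂P, (fun t => Y t ω) ∈ infiniteTimePaths ((-1 : ℝ) : EReal) ⊤) ∧
      HasLaw (fun ω => firstJumpTime (leftFastForward (-1) (fun t => Y t ω)))
        (expMeasure (grunwaldCoeff φ h 0)) P ∧
      ∀ j : ℕ, 1 ≤ j →
        P.real {ω | firstJumpState (leftFastForward (-1) (fun t => Y t ω)) =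
            -1 + (1 + (j : ℝ)) * h} =
          -(∑ i ∈ Finset.range (j + 1), grunwaldCoeff φ h i) / grunwaldCoeff φ h 0 := by
  classical
  obtain ⟨hprob, Z, hZ, hdownZ, hpath⟩ := hY.exists_isWalkSequence hφ hh
  have hG := hφ.grunwaldCoeff_one_neg hh
  have hG0 := hφ.grunwaldCoeff_zero_pos hh
  have hr : 0 < -grunwaldCoeff φ h 1 := by linarith
  have hp := hφ.gridStepLaw_real_neg_one_pos hh
  have hocc := hZ.ae_tendsto_occupation (B := Ici 0) hr (hφ.integrable_gridStepLaw hh)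
    (hφ.integral_gridStepLaw hh) (Or.inl (isUpperSet_Ici 0)) (mem_Ici.2 le_rfl)
  have hexit := hZ.ae_exists_exit (B := Ici 0) (D := Iic 0) hr (by
    simpa only [mem_Iic] using hφ.tendsto_walkWeight_Iic hh)
  have hspec : ∀ᵐ ω ∂P, IsCadlagPath (fun t => Y t ω) ∧
      volume {t : ℝ | 0 ≤ t ∧ Y t ω ∈ Ioi (-1)} = ⊤ ∧
      firstJumpTime (leftFastForward (-1) (fun t => Y t ω)) = (walkExit (Ici 0) (Iic 0) Z ω).1 ∧
      firstJumpState (leftFastForward (-1) (fun t => Y t ω)) =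
        -1 + h + h * ((walkExit (Ici 0) (Iic 0) Z ω).2 : ℝ) := by
    filter_upwards [hocc, hexit, hpath] with ω h1 h2 h3
    refine gridPath_fastForward hh (fun i => hZ.pos i ω) h3 (fun k => ?_) (mem_Ici.2 le_rfl)
      (fun k h4 h5 => le_antisymm h5 h4) (mem_Iic.2 le_rfl) (fun k hk => mem_Ici.2 (not_le.1 hk).le) h1 h2
    rw [mem_Ioi, mem_Ici]
    constructor
    · intro hk
      by_contra! hneg
      have : (k : ℝ) ≤ -1 := by exact_mod_cast (by omega : k ≤ -1)
      nlinarith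
    · intro hk
      have : (0 : ℝ) ≤ k := by exact_mod_cast hk
      nlinarith
  refine ⟨?_, ?_, fun j hj => ?_⟩
  · filter_upwards [hspec] with ω hω
    refine ⟨hω.1, ?_⟩
    convert! hω.2.1 using 4 with t
    simp only [mem_Ioi, EReal.coe_lt_coe_iff, EReal.coe_lt_top, and_true]
  · have h1 := hZ.hasLaw_walkExit_Iic hr ae_gridStepLaw hp
      (fun y hy => hφ.tendsto_walkWeight_Ici hh hy) hexit
    -- The rate is $pr=\frac{\mathcal G_0}{-\mathcal G_1}\cdot(-\mathcal G_1)=\mathcal G_0$.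
    rw [hφ.gridStepLaw_real_neg_one hh, div_mul_cancel₀ _ hr.ne'] at h1
    exact h1.congr (by filter_upwards [hspec] with ω hω using hω.2.2.1)
  · have h1 := hZ.measureReal_exit_Iic hr ae_gridStepLaw hp
      (fun y hy => hφ.tendsto_walkWeight_Ici hh hy) hexit (x := j) (by omega)
    rw [hφ.gridStepLaw_real_neg_one hh, hφ.gridStepLaw_real_Ici hh hj,
      div_div_div_cancel_right₀ hr.ne'] at h1
    rw [← h1]
    refine measureReal_congr ?_
    filter_upwards [hspec] with ω hω
    refine propext ?_
    change firstJumpState (leftFastForward (-1) (fun t => Y t ω)) = -1 + (1 + (j : ℝ)) * h ↔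
      (walkExit (Ici 0) (Iic 0) Z ω).2 = j
    rw [hω.2.2.2]
    constructor
    · intro heq
      have h2 : h * ((walkExit (Ici 0) (Iic 0) Z ω).2 : ℝ) = h * j := by linarith
      exact_mod_cast mul_left_cancel₀ hh.ne' h2
    · intro heq
      rw [heq]
      push_cast
      ring

/-- Position `k` is now the state $1-h+kh$, hidden exactly when $k\ge1$. As no step is below $-1$,
the walk can leave $[0,\infty)$ only onto $-1$, the state $1-2h$. -/
lemma rightFastForward_grunwaldProcess {Y : ℝ → Ω → ℝ} (hφ : AdmissibleLevyMeasure φ)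
    (hh : 0 < h) (hY : IsGrunwaldProcess P Y φ h (1 - h)) :
    (∀ᵐ ω ∂P, (fun t => Y t ω) ∈ infiniteTimePaths ⊥ ((1 : ℝ) : EReal)) ∧
      HasLaw (fun ω => firstJumpTime (rightFastForward 1 (fun t => Y t ω)))
        (expMeasure (grunwaldCoeff φ h 0)) P ∧
      ∀ᵐ ω ∂P, firstJumpState (rightFastForward 1 (fun t => Y t ω)) = 1 - 2 * h := by
  classical
  obtain ⟨hprob, Z, hZ, hdownZ, hpath⟩ := hY.exists_isWalkSequence hφ hh
  have hG := hφ.grunwaldCoeff_one_neg hh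
  have hr : 0 < -grunwaldCoeff φ h 1 := by linarith
  have hp := hφ.gridStepLaw_real_neg_one_pos hh
  have hocc := hZ.ae_tendsto_occupation (B := Iic 0) hr (hφ.integrable_gridStepLaw hh)
    (hφ.integral_gridStepLaw hh) (Or.inr (isLowerSet_Iic 0)) (mem_Iic.2 le_rfl)
  have hexit := hZ.ae_exists_exit (B := Iic 0) (D := Ici 0) hr (by
    simpa only [mem_Ici] using hφ.tendsto_walkWeight_Ici hh le_rfl)
  have hspec : ∀ᵐ ω ∂P, IsCadlagPath (fun t => Y t ω) ∧
      volume {t : ℝ | 0 ≤ t ∧ Y t ω ∈ Iio 1} = ⊤ ∧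
      firstJumpTime (rightFastForward 1 (fun t => Y t ω)) = (walkExit (Iic 0) (Ici 0) Z ω).1 ∧
      firstJumpState (rightFastForward 1 (fun t => Y t ω)) =
        1 - h + h * ((walkExit (Iic 0) (Ici 0) Z ω).2 : ℝ) := by
    filter_upwards [hocc, hexit, hpath] with ω h1 h2 h3
    refine gridPath_fastForward hh (fun i => hZ.pos i ω) h3 (fun k => ?_) (mem_Iic.2 le_rfl)
      (fun k h4 h5 => le_antisymm h4 h5) (mem_Ici.2 le_rfl) (fun k hk => mem_Iic.2 (not_le.1 hk).le) h1 h2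
    rw [mem_Iio, mem_Iic]
    constructor
    · intro hk
      by_contra! hneg
      have : (1 : ℝ) ≤ k := by exact_mod_cast (by omega : 1 ≤ k)
      nlinarith
    · intro hk
      have : (k : ℝ) ≤ 0 := by exact_mod_cast hk
      nlinarith
  refine ⟨?_, ?_, ?_⟩
  · filter_upwards [hspec] with ω hω
    refine ⟨hω.1, ?_⟩
    convert! hω.2.1 using 4 with t
    simp only [mem_Iio, EReal.coe_lt_coe_iff, EReal.bot_lt_coe, true_and]
  · have h1 := hZ.hasLaw_walkExit_Ici hr ae_gridStepLaw hp hexit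
    rw [hφ.gridStepLaw_real_neg_one hh, div_mul_cancel₀ _ hr.ne'] at h1
    exact h1.congr (by filter_upwards [hspec] with ω hω using hω.2.2.1)
  · filter_upwards [hspec, hdownZ, hexit] with ω hω h1 h2
    have h3 := walkExit_snd_notMem h2
    rw [mem_Ici, not_le] at h3
    have h4 : (walkExit (Iic 0) (Ici 0) Z ω).2 = -1 :=
      le_antisymm (by omega) (neg_one_le_walkExit_Ici h1)
    rw [hω.2.2.2, h4]
    push_cast
    ring

end

theorem theorem3p6 {Ω : Type*} [MeasurableSpace Ω] (P : Measure Ω) [IsProbabilityMeasure P]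
    (φ : Measure ℝ) (hφ : AdmissibleLevyMeasure φ) (h : ℝ) (hh : 0 < h) (Y : ℝ → Ω → ℝ) :
    (IsGrunwaldProcess P Y φ h (-1 + h) →
      (∀ᵐ ω ∂P, (fun t => Y t ω) ∈ infiniteTimePaths ((-1 : ℝ) : EReal) ⊤) ∧
      HasLaw (fun ω => firstJumpTime (leftFastForward (-1) (fun t => Y t ω)))
        (expMeasure (grunwaldCoeff φ h 0)) P ∧
      ∀ j : ℕ, 1 ≤ j →
        P.real {ω | firstJumpState (leftFastForward (-1) (fun t => Y t ω)) =
            -1 + (1 + (j : ℝ)) * h} =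
          -(∑ i ∈ Finset.range (j + 1), grunwaldCoeff φ h i) / grunwaldCoeff φ h 0) ∧
    (IsGrunwaldProcess P Y φ h (1 - h) →
      (∀ᵐ ω ∂P, (fun t => Y t ω) ∈ infiniteTimePaths ⊥ ((1 : ℝ) : EReal)) ∧
      HasLaw (fun ω => firstJumpTime (rightFastForward 1 (fun t => Y t ω)))
        (expMeasure (grunwaldCoeff φ h 0)) P ∧
      ∀ᵐ ω ∂P, firstJumpState (rightFastForward 1 (fun t => Y t ω)) = 1 - 2 * h) := by
  exact ⟨leftFastForward_grunwaldProcess hφ hh, rightFastForward_grunwaldProcess hφ hh⟩
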